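/- Fix a finite local state space $S$, two row-stochastic kernels $P_0$ (idle) and $P_1$ (activate) on $S$, an injective priority index $\nu\colon S\to\mathbb{R}$, and a budget fraction $\alpha\in\mathbb{R}$. **The $N$-agent restless bandit.** For integers $N\ge 1$ and $M$ with $M=\alpha N$, consider $N$ agents with global states $s=(s_1,\dots,s_N)\in S^N$ and joint actions $a\in\{0,1\}^N$. Given $(s,a)$ the agents move independently: $P(s'\mid s,a)=\prod_i P_{a_i}(s_i'\mid s_i)$. The index policy $\pi$ activates exactly $M$ agents, in descending order of $\nu_{s_i}$, ties between agents in the same state being broken by uniform random sampling. Each agent has the local reward $r(s_i,a_i)$ with $|r|\le r_{\max}$, and $\gamma\in[0,1)$ is the discount factor. Let $P^\pi(s',a'\mid s,a)=P(s'\mid s,a)\,\pi(a'\mid s')$, let $\mu$ be a stationary distribution of the global state under $\pi$, and let $\mu(s,a)=\mu(s)\pi(a\mid s)$ be its occupancy measure. The global Q-value is $Q^\pi_{1:N}=(I-\gamma P^\pi)^{-1}r_{1:N}$ with $r_{1:N}(s,a)=\sum_i r(s_i,a_i)$. The local Q-value of agent $i$ is $Q^\pi_i=(I-\gamma P^\pi_i)^{-1}r$,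 where $$P_i^\pi(s_i',a_i'\mid s_i,a_i)=\sum_{s'_{-i},a'_{-i}}\ \sum_{s_{-i},a_{-i}}P^\pi(s',a'\mid s,a)\,\mu(s_{-i},a_{-i}\mid s_i,a_i)$$ (pairs $(s_i,a_i)$ of $\mu$-probability zero are irrelevant and get a zero row). **Mean-field dynamics.** For a configuration $m$ in the simplex $\Delta(S)$, let $x_s(m)=\max\{0,\min\{m_s,\ \alpha-\sum_{s':\nu_{s'}>\nu_s}m_{s'}\}\}$ be the mass of agents in state $s$ that is activated, let $\pi_m(s,1)=x_s(m)/m_s$ and $\pi_m(s,0)=1-\pi_m(s,1)$ (with $\pi_m(s,1)=0$ if $m_s=0$), and let $\phi(m)_{s'}=\sum_{s,a}m_s\,\pi_m(s,a)\,P_a(s'\mid s)$ be the expected next configuration. Assume that some $m^\ast\in\Delta(S)$ satisfies: - (i) non-degeneracy: there is $s\in S$ with $0<\pi_{m^\ast}(s,0)<1$; - (ii) UGAP: for every $\varepsilon>0$ there is $T$ such that $\|\phi^t(m)-m^\ast\|_\infty<\varepsilon$ for all $t\ge T$ and all $m\in\Delta(S)$. **Claim.** There is a constant $C>0$, depending only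 on $S,P_0,P_1,\nu,\alpha$ and in particular independent of $N$, such that for all $r$, $r_{\max}$ with $|r|\le r_{\max}$, all $\gamma\in[0,1)$, all $N\ge1$ and $M$ with $M=\alpha N$, and every stationary distribution $\mu$ as above, $$\sum_{s,a}\mu(s,a)\,\Bigl|Q^\pi_{1:N}(s,a)-\sum_{i=1}^N Q^\pi_i(s_i,a_i)\Bigr|\ \le\ \frac{4C\gamma\sqrt N\,r_{\max}}{(1-\gamma)^2}.$$ In particular the decomposition error is sublinear, $O(\sqrt N)$. -/

import Mathlib

open scoped BigOperators Matrix

noncomputable section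

namespace RMAB

variable {S : Type*} [Fintype S] [DecidableEq S]

/-! ### The `N`-agent restless bandit and its index policy

All agents share the finite local state space `S` and the local kernels `P 0` (idle) and
`P 1` (activate).  A global state is a map `Fin N → S`, a joint action a map `Fin N → Fin 2`. -/

/-- A global state-action pair of the `N`-agent system. -/
abbrev Pair (S : Type*) (N : ℕ) : Type _ := (Fin N → S) × (Fin N → Fin 2)

/-- The joint actions which activate exactly `M` agents and respect the priority `ν` in the global
state `s`: an agent may be activated only if every agent of strictly higher priority is. -/
def priorityActions (ν : S → ℝ) {N : ℕ} (M : ℕ) (s : Fin N → S) : Finset (Fin N → Fin 2) :=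
  Finset.univ.filter fun a =>
    (Finset.univ.filter fun i => a i = 1).card = M ∧
      ∀ i j, ν (s j) < ν (s i) → a j = 1 → a i = 1

/-- The index policy with priority index `ν` and budget `M`: agents are activated in descending
order of priority until `M` of them are active.  For an injective `ν` the only ties are between
agents in the same state; they are broken by uniform sampling, so that the joint action is
uniformly distributed on `priorityActions ν M s`. -/
def indexPolicy (ν : S → ℝ) {N : ℕ} (M : ℕ) (s : Fin N → S) (a : Fin N → Fin 2) : ℝ :=
  if a ∈ priorityActions ν M s then ((priorityActions ν M s).card : ℝ)⁻¹ else 0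

/-- The global kernel `P(s' ∣ s, a) = ∏ i, P_{a i}(s' i ∣ s i)`: given the actions, the agents
move independently. -/
def globalKernel (P : Fin 2 → Matrix S S ℝ) {N : ℕ} (s : Fin N → S) (a : Fin N → Fin 2)
    (s' : Fin N → S) : ℝ :=
  ∏ i, P (a i) (s i) (s' i)

/-- The transition matrix of the global state under a policy `π`. -/
def stateTransition (P : Fin 2 → Matrix S S ℝ) {N : ℕ}
    (π : (Fin N → S) → (Fin N → Fin 2) → ℝ) : Matrix (Fin N → S) (Fin N → S) ℝ :=
  fun s s' => ∑ a, π s a * globalKernel P s a s'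

/-- The transition matrix `P(s' ∣ s, a) π(a' ∣ s')` of the global state-action pair under `π`. -/
def pairTransition (P : Fin 2 → Matrix S S ℝ) {N : ℕ}
    (π : (Fin N → S) → (Fin N → Fin 2) → ℝ) : Matrix (Pair S N) (Pair S N) ℝ :=
  fun x y => globalKernel P x.1 x.2 y.1 * π y.1 y.2

/-- `μ` is a stationary distribution of the global state under `π`. -/
def IsStationary (P : Fin 2 → Matrix S S ℝ) {N : ℕ}
    (π : (Fin N → S) → (Fin N → Fin 2) → ℝ) (μ : (Fin N → S) → ℝ) : Prop :=
  μ ∈ stdSimplex ℝ (Fin N → S) ∧ μ ᵥ* stateTransition P π = μ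

/-- The occupancy measure `μ(s, a) = μ(s) π(a ∣ s)`. -/
def occupancy {N : ℕ} (π : (Fin N → S) → (Fin N → Fin 2) → ℝ) (μ : (Fin N → S) → ℝ)
    (x : Pair S N) : ℝ :=
  μ x.1 * π x.1 x.2

/-! ### Global and local Q-values -/

/-- The state-action pair of agent `i` in a global state-action pair. -/
def agentPair {N : ℕ} (i : Fin N) (x : Pair S N) : S × Fin 2 := (x.1 i, x.2 i)

/-- The global reward, the sum of the local rewards `r a s`. -/
def globalReward (r : Fin 2 → S → ℝ) {N : ℕ} (x : Pair S N) : ℝ :=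
  ∑ i, r (x.2 i) (x.1 i)

/-- The global Q-value `(I - γ P^π)⁻¹ r`. -/
def globalQ (P : Fin 2 → Matrix S S ℝ) (r : Fin 2 → S → ℝ) (γ : ℝ) {N : ℕ}
    (π : (Fin N → S) → (Fin N → Fin 2) → ℝ) : Pair S N → ℝ :=
  (1 - γ • pairTransition P π)⁻¹ *ᵥ globalReward r

/-- The marginal on the pairs of agent `i` of a measure on the global pairs. -/
def agentMarginal {N : ℕ} (ρ : Pair S N → ℝ) (i : Fin N) (u : S × Fin 2) : ℝ :=
  ∑ x with agentPair i x = u, ρ x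

/-- The local transition matrix of agent `i`: the global transition, projected to agent `i` and
averaged with the conditional occupancy measure of the other agents,
`P_i(u' ∣ u) = ∑_{y : y_i = u'} ∑_{x : x_i = u} P^π(y ∣ x) ρ(x) / ρ_i(u)`.
Pairs `u` with `ρ_i(u) = 0` are never visited; their rows are set to zero, and they are not
reached from the other pairs. -/
def localTransition (P : Fin 2 → Matrix S S ℝ) {N : ℕ}
    (π : (Fin N → S) → (Fin N → Fin 2) → ℝ) (μ : (Fin N → S) → ℝ) (i : Fin N) :
    Matrix (S × Fin 2) (S × Fin 2) ℝ :=
  fun u u' => ∑ y with agentPair i y = u', ∑ x with agentPair i x = u,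
    pairTransition P π x y * (occupancy π μ x / agentMarginal (occupancy π μ) i u)

/-- The local Q-value of agent `i`, `(I - γ P_i)⁻¹ r`. -/
def localQ (P : Fin 2 → Matrix S S ℝ) (r : Fin 2 → S → ℝ) (γ : ℝ) {N : ℕ}
    (π : (Fin N → S) → (Fin N → Fin 2) → ℝ) (μ : (Fin N → S) → ℝ) (i : Fin N) :
    S × Fin 2 → ℝ :=
  (1 - γ • localTransition P π μ i)⁻¹ *ᵥ fun u => r u.2 u.1

/-- The seminorm `∑ x, ρ x * |f x|`. -/
def weightedNorm {X : Type*} [Fintype X] (ρ f : X → ℝ) : ℝ := ∑ x, ρ x * |f x|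

/-- The decomposition error `‖Q(s, a) - ∑ i, Q_i(s_i, a_i)‖` in the norm weighted by the occupancy
measure. -/
def decompositionError (P : Fin 2 → Matrix S S ℝ) (r : Fin 2 → S → ℝ) (γ : ℝ) {N : ℕ}
    (π : (Fin N → S) → (Fin N → Fin 2) → ℝ) (μ : (Fin N → S) → ℝ) : ℝ :=
  weightedNorm (occupancy π μ) fun x =>
    globalQ P r γ π x - ∑ i, localQ P r γ π μ i (agentPair i x)

/-! ### The mean-field dynamics of the index policy

A configuration `m` lies in `stdSimplex ℝ S`; `m s` is the proportion of agents in state `s`. -/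

/-- The proportion of agents that are in state `s` and get activated by the index policy with
budget fraction `α` in the configuration `m`: as many agents in state `s` as the budget left over by
the states of higher priority allows. -/
def activeMass (ν : S → ℝ) (α : ℝ) (m : S → ℝ) (s : S) : ℝ :=
  max 0 (min (m s) (α - ∑ s' with ν s < ν s', m s'))

/-- The probability `π_m(s, a)` that an agent in state `s` takes action `a` under the index policy
in the configuration `m`.  It is meaningful where `m s ≠ 0`; where `m s = 0` the agent
is taken to be idle with probability one. -/
def meanFieldPolicy (ν : S → ℝ) (α : ℝ) (m : S → ℝ) (s : S) (a : Fin 2) : ℝ :=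
  if a = 1 then activeMass ν α m s / m s else 1 - activeMass ν α m s / m s

/-- The expected next configuration `φ(m) = E[m[t+1] ∣ m[t] = m]` under the index policy with
budget fraction `α`. -/
def configMap (P : Fin 2 → Matrix S S ℝ) (ν : S → ℝ) (α : ℝ) (m : S → ℝ) : S → ℝ :=
  fun s' => ∑ s, ∑ a, m s * meanFieldPolicy ν α m s a * P a s s'

/-- Uniform global attractor property: the iterates of the configuration map converge to `mstar`,
uniformly over all initial configurations (`‖·‖` is the sup norm on `S → ℝ`). -/
def UGAP (P : Fin 2 → Matrix S S ℝ) (ν : S → ℝ) (α : ℝ) (mstar : S → ℝ) : Prop :=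
  mstar ∈ stdSimplex ℝ S ∧
    ∀ ε : ℝ, 0 < ε → ∃ T : ℕ, ∀ t : ℕ, T ≤ t → ∀ m ∈ stdSimplex ℝ S,
      ‖(configMap P ν α)^[t] m - mstar‖ < ε

/-- Non-degeneracy: under the configuration `mstar` the policy randomizes in some state. -/
def NonDegenerate (ν : S → ℝ) (α : ℝ) (mstar : S → ℝ) : Prop :=
  ∃ s, 0 < meanFieldPolicy ν α mstar s 0 ∧ meanFieldPolicy ν α mstar s 0 < 1

end RMAB

end

/-! Subtracting Bellman equations, the defect `D = Q - ∑ i, Q_i` solves `D = γ P^π D + γ g`, where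
`g` sums over the agents the difference between the true law of the agent's next pair (given the
global pair) and its local law, integrated against `Q_i`. Each `Q_i` is bounded by `rmax / (1 - γ)`,
and integrating `|D|` against the stationary occupancy measure costs a second factor `1 / (1 - γ)`.
The local law is a conditional expectation of the true one, so comparing both with any common kernel
`K` costs only a factor two (`decompositionError_le`).

For `K` take the mean-field kernel frozen at `mstar`. By exchangeability, an agent's next action
depends on the next global state only through its own local state and the configuration. Hence the
discrepancy summed over agents is `O(N)` times the mean distance of the next configuration from
`mstar` (`sum_abs_agentTransition_sub_le`).

It remains to see that this distance is `O(1 / √N)` in stationarity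
(`exists_sum_mul_norm_config_sub_le`). In one step the configuration follows `φ` up to a mean error
`|S| / √N`, by a variance bound (`sum_globalKernel_mul_norm_le`). As `φ` is Lipschitz, the errors
over a fixed number `T` of steps stay `O(1 / √N)`. If `φ^[T]` halves distances to `mstar`,
stationarity gives `E ≤ E / 2 + O(1 / √N)`. Such a `T` exists (`exists_iterate_contraction`):
non-degeneracy makes `φ` affine near `mstar`, so uniform convergence seen at one small scale `η`
rescales to all smaller distances. -/

namespace RMAB

/-! ### Bellman equations for substochastic matrices -/

section Resolvent

variable {X : Type*} [Fintype X]

/-- The maximum principle for the equation `v = r + γ A v` with a substochastic matrix `A`. -/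
lemma abs_le_of_eq_add_smul_mulVec {A : Matrix X X ℝ} (h0 : ∀ x y, 0 ≤ A x y)
    (h1 : ∀ x, ∑ y, A x y ≤ 1) {γ : ℝ} (hγ0 : 0 ≤ γ) (hγ1 : γ < 1) {v r : X → ℝ} {R : ℝ}
    (hr : ∀ x, |r x| ≤ R) (hv : ∀ x, v x = r x + γ * ∑ y, A x y * v y) (x : X) :
    |v x| ≤ R / (1 - γ) := by
  have : Nonempty X := ⟨x⟩
  obtain ⟨z, hz⟩ := Finite.exists_max fun x => |v x|
  refine (hz x).trans ?_
  rw [le_div_iff₀ (by linarith)]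
  have hsum : |∑ y, A z y * v y| ≤ |v z| := by
    calc |∑ y, A z y * v y| ≤ ∑ y, A z y * |v z| := by
          refine (Finset.abs_sum_le_sum_abs _ _).trans (Finset.sum_le_sum fun y _ => ?_)
          rw [abs_mul, abs_of_nonneg (h0 z y)]
          exact mul_le_mul_of_nonneg_left (hz y) (h0 z y)
      _ = (∑ y, A z y) * |v z| := by rw [Finset.sum_mul]
      _ ≤ 1 * |v z| := by gcongr; exact h1 z
      _ = |v z| := one_mul _
  have h2 : |v z| ≤ R + γ * |v z| := by
    calc |v z| = |r z + γ * ∑ y, A z y * v y| := by rw [← hv z]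
      _ ≤ |r z| + |γ * ∑ y, A z y * v y| := abs_add_le _ _
      _ ≤ R + γ * |v z| := by
          rw [abs_mul, abs_of_nonneg hγ0]
          gcongr
          exact hr z
  linarith

/-- A null vector solves `v = γ A v`, and the maximum principle with zero reward kills it.
Substochasticity suffices, which admits the zero rows of the local kernels. -/
lemma isUnit_det_one_sub_smul [DecidableEq X] {A : Matrix X X ℝ} (h0 : ∀ x y, 0 ≤ A x y)
    (h1 : ∀ x, ∑ y, A x y ≤ 1) {γ : ℝ} (hγ0 : 0 ≤ γ) (hγ1 : γ < 1) :
    IsUnit (1 - γ • A).det := by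
  rw [isUnit_iff_ne_zero]
  intro hdet
  obtain ⟨v, hv, hAv⟩ := Matrix.exists_mulVec_eq_zero_iff.2 hdet
  apply hv
  funext x
  have hx := abs_le_of_eq_add_smul_mulVec (r := 0) (v := v) (R := 0) h0 h1 hγ0 hγ1 (by simp)
    (fun x => by
      have := congrFun hAv x
      rw [Matrix.sub_mulVec, Matrix.one_mulVec, Matrix.smul_mulVec] at this
      change v x - γ * ∑ y, A x y * v y = 0 at this
      simp only [Pi.zero_apply]
      linarith) x
  simpa using hx

/-- The Q-values enter the later estimates only through this fixed-point equation, never through the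
matrix inverse. -/
lemma resolvent_mulVec_apply [DecidableEq X] {A : Matrix X X ℝ} (h0 : ∀ x y, 0 ≤ A x y)
    (h1 : ∀ x, ∑ y, A x y ≤ 1) {γ : ℝ} (hγ0 : 0 ≤ γ) (hγ1 : γ < 1) (r : X → ℝ) (x : X) :
    ((1 - γ • A)⁻¹ *ᵥ r) x = r x + γ * ∑ y, A x y * ((1 - γ • A)⁻¹ *ᵥ r) y := by
  have h : (1 - γ • A) *ᵥ ((1 - γ • A)⁻¹ *ᵥ r) = r := by
    rw [Matrix.mulVec_mulVec, Matrix.mul_nonsing_inv _ (isUnit_det_one_sub_smul h0 h1 hγ0 hγ1),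
      Matrix.one_mulVec]
  generalize (1 - γ • A)⁻¹ *ᵥ r = v at h ⊢
  have := congrFun h x
  rw [Matrix.sub_mulVec, Matrix.one_mulVec, Matrix.smul_mulVec] at this
  change v x - γ * ∑ y, A x y * v y = r x at this
  linarith

end Resolvent

/-! ### Moments of sums of independent variables -/

section ProductKernel

variable {S : Type*} [Fintype S] {N : ℕ}

lemma sum_prod_eq_one {p : Fin N → S → ℝ} (hp : ∀ i, ∑ t, p i t = 1) :
    ∑ s : Fin N → S, ∏ i, p i (s i) = 1 := by
  classical
  have := Finset.prod_univ_sum (fun _ : Fin N => (Finset.univ : Finset S)) p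
  rw [Fintype.piFinset_univ] at this
  rw [← this]
  simp [hp]

/-- The test function is absorbed as a factor that is trivial away from `j`; the sum then factorizes
and the other coordinates integrate to one. -/
lemma sum_prod_mul_apply {p : Fin N → S → ℝ} (hp : ∀ i, ∑ t, p i t = 1) (j : Fin N)
    (g : S → ℝ) : ∑ s : Fin N → S, (∏ i, p i (s i)) * g (s j) = ∑ t, p j t * g t := by
  classical
  have h := Finset.prod_univ_sum (fun _ : Fin N => (Finset.univ : Finset S))
    (fun i t => p i t * if i = j then g t else 1)
  rw [Fintype.piFinset_univ] at h
  simp only [Finset.prod_mul_distrib, Finset.prod_ite_eq', Finset.mem_univ, if_true] at h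
  rw [← h, Finset.prod_eq_single j (fun i _ hij => by simp [hij, hp i]) (by simp)]
  simp

lemma sum_prod_mul_apply_mul_apply {p : Fin N → S → ℝ} {j k : Fin N} (hjk : j ≠ k)
    {g : S → ℝ} (hg : ∑ t, p j t * g t = 0) (h : S → ℝ) :
    ∑ s : Fin N → S, (∏ i, p i (s i)) * (g (s j) * h (s k)) = 0 := by
  classical
  have e := Finset.prod_univ_sum (fun _ : Fin N => (Finset.univ : Finset S))
    (fun i t => p i t * ((if i = j then g t else 1) * if i = k then h t else 1))
  rw [Fintype.piFinset_univ] at e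
  simp only [Finset.prod_mul_distrib, Finset.prod_ite_eq', Finset.mem_univ, if_true] at e
  rw [← e]
  exact Finset.prod_eq_zero (Finset.mem_univ j) (by simp [hjk, hg])

/-- The variance of a sum of independent centred variables bounded by one is at most their
number. -/
lemma sum_prod_mul_sq_le {p : Fin N → S → ℝ} (hp0 : ∀ i t, 0 ≤ p i t)
    (hp : ∀ i, ∑ t, p i t = 1) {h : Fin N → S → ℝ} (hh : ∀ i t, |h i t| ≤ 1)
    (hc : ∀ i, ∑ t, p i t * h i t = 0) :
    ∑ s : Fin N → S, (∏ i, p i (s i)) * (∑ i, h i (s i)) ^ 2 ≤ N := by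
  have hexp : ∀ s : Fin N → S, (∏ i, p i (s i)) * (∑ i, h i (s i)) ^ 2 =
      ∑ j, ∑ k, (∏ i, p i (s i)) * (h j (s j) * h k (s k)) := by
    intro s
    rw [sq, Finset.sum_mul_sum, Finset.mul_sum]
    simp only [Finset.mul_sum]
  simp only [hexp]
  rw [Finset.sum_comm]
  have hj : ∀ j : Fin N, ∑ s : Fin N → S, ∑ k, (∏ i, p i (s i)) * (h j (s j) * h k (s k)) ≤ 1 := by
    intro j
    -- Independence and centring remove the cross terms, leaving the second moment of the single
    -- variable `j`.
    rw [Finset.sum_comm, Finset.sum_eq_single j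
      (fun k _ hk => sum_prod_mul_apply_mul_apply (Ne.symm hk) (hc j) _) (by simp)]
    rw [sum_prod_mul_apply hp j (fun t => h j t * h j t), ← hp j]
    refine Finset.sum_le_sum fun t _ => mul_le_of_le_one_right (hp0 j t) ?_
    have := hh j t
    rw [← abs_mul_abs_self]
    exact mul_le_one₀ this (abs_nonneg _) this
  calc _ ≤ ∑ _j : Fin N, (1 : ℝ) := Finset.sum_le_sum fun j _ => hj j
    _ = N := by simp

/-- The expectation of `(|X| - √N)² ≥ 0`, that is `2 √N |X| ≤ N + X²`, turns the variance bound into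
a first-moment bound. -/
lemma sum_prod_mul_abs_le {p : Fin N → S → ℝ} (hp0 : ∀ i t, 0 ≤ p i t)
    (hp : ∀ i, ∑ t, p i t = 1) {h : Fin N → S → ℝ} (hh : ∀ i t, |h i t| ≤ 1)
    (hc : ∀ i, ∑ t, p i t * h i t = 0) (hN : 0 < N) :
    ∑ s : Fin N → S, (∏ i, p i (s i)) * |∑ i, h i (s i)| ≤ √N := by
  have hN' : (0 : ℝ) < √N := Real.sqrt_pos.2 (by exact_mod_cast hN)
  have hsq : √(N : ℝ) * √N = N := Real.mul_self_sqrt (by positivity)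
  have h2 : (2 * √N) * ∑ s : Fin N → S, (∏ i, p i (s i)) * |∑ i, h i (s i)| ≤ (2 * √N) * √N := by
    calc _ ≤ ∑ s : Fin N → S, (N * (∏ i, p i (s i)) +
            (∏ i, p i (s i)) * (∑ i, h i (s i)) ^ 2) := by
          rw [Finset.mul_sum]
          refine Finset.sum_le_sum fun s _ => ?_
          have hnn : 0 ≤ ∏ i, p i (s i) := Finset.prod_nonneg fun i _ => hp0 i _
          have := mul_nonneg hnn (sq_nonneg (|∑ i, h i (s i)| - √N))
          rw [sub_sq, sq_abs, Real.sq_sqrt (by positivity)] at this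
          linarith
      _ ≤ N + N := by
          rw [Finset.sum_add_distrib, ← Finset.mul_sum, sum_prod_eq_one hp, mul_one]
          linarith [sum_prod_mul_sq_le hp0 hp hh hc]
      _ = _ := by linarith
  exact le_of_mul_le_mul_left h2 (by positivity)

end ProductKernel

/-! ### Configurations of global states -/

section Config

lemma sum_eq_add_sum_filter_lt {S : Type*} [Fintype S]
    {ν : S → ℝ} (hν : Function.Injective ν) (t : S) (f : S → ℝ) :
    ∑ t', f t' = f t + ∑ t' with ν t < ν t', f t' + ∑ t' with ν t' < ν t, f t' := by
  classical
  have ht : f t = ∑ t', if t' = t then f t' else 0 := by simp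
  rw [ht, Finset.sum_filter, Finset.sum_filter, ← Finset.sum_add_distrib,
    ← Finset.sum_add_distrib]
  refine Finset.sum_congr rfl fun t' _ => ?_
  rcases lt_trichotomy (ν t) (ν t') with h | h | h
  · have : t' ≠ t := by rintro rfl; exact lt_irrefl _ h
    simp [h, this, h.le]
  · simp [hν h]
  · have : t' ≠ t := by rintro rfl; exact lt_irrefl _ h
    simp [h, this, h.le]

variable {S : Type*} [DecidableEq S] {N : ℕ}

/-- The configuration of a global state: the proportions of agents in the local states. -/
noncomputable def config (s : Fin N → S) (t : S) : ℝ :=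
  ((Finset.univ.filter fun i => s i = t).card : ℝ) / N

lemma config_mem_stdSimplex [Fintype S] (hN : 0 < N) (s : Fin N → S) : config s ∈ stdSimplex ℝ S := by
  refine ⟨fun t => by unfold config; positivity, ?_⟩
  have hN' : (N : ℝ) ≠ 0 := by exact_mod_cast hN.ne'
  have h := Finset.card_eq_sum_card_fiberwise (s := (Finset.univ : Finset (Fin N)))
    (t := (Finset.univ : Finset S)) (f := s) (by simp [Set.MapsTo])
  simp only [config, ← Finset.sum_div]
  rw [div_eq_one_iff_eq hN', ← Nat.cast_sum, ← h]
  simp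

lemma natCast_mul_config (hN : 0 < N) (s : Fin N → S) (t : S) :
    (N : ℝ) * config s t = ((Finset.univ.filter fun i => s i = t).card : ℝ) := by
  have hN' : (N : ℝ) ≠ 0 := by exact_mod_cast hN.ne'
  unfold config
  field_simp

end Config

/-! ### The index policy and its one-agent marginals -/

section Policy

variable {S : Type*} {N : ℕ}

lemma mem_priorityActions {ν : S → ℝ} {M : ℕ} {s : Fin N → S} {a : Fin N → Fin 2} :
    a ∈ priorityActions ν M s ↔ (Finset.univ.filter fun i => a i = 1).card = M ∧
      ∀ i j, ν (s j) < ν (s i) → a j = 1 → a i = 1 := by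
  simp [priorityActions]

/-- Greedy construction: activate one more idle agent, of highest priority among the idle ones. -/
lemma priorityActions_nonempty (ν : S → ℝ) {M : ℕ} (hM : M ≤ N) (s : Fin N → S) :
    (priorityActions ν M s).Nonempty := by
  induction M with
  | zero => exact ⟨fun _ => 0, mem_priorityActions.2 (by simp)⟩
  | succ M ih =>
    obtain ⟨a, ha⟩ := ih (by omega)
    obtain ⟨hcard, hprio⟩ := mem_priorityActions.1 ha
    have hne : (Finset.univ.filter fun i => a i ≠ 1).Nonempty := by
      rw [← Finset.card_pos]
      have := Finset.card_filter_add_card_filter_not (s := (Finset.univ : Finset (Fin N)))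
        (fun i => a i = 1)
      simp only [Finset.card_univ, Fintype.card_fin, hcard] at this
      simp only [ne_eq]
      omega
    obtain ⟨k, hk, hmax⟩ := Finset.exists_max_image _ (fun i => ν (s i)) hne
    have hk' : a k ≠ 1 := by simpa using hk
    refine ⟨Function.update a k 1, mem_priorityActions.2 ⟨?_, fun i j hij haj => ?_⟩⟩
    · have : (Finset.univ.filter fun i => Function.update a k 1 i = 1) =
          insert k (Finset.univ.filter fun i => a i = 1) := by
        ext i
        by_cases h : i = k
        · simp [h]
        · simp [h]
      rw [this, Finset.card_insert_of_notMem (by simpa using hk'), hcard]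
    · by_cases hi : i = k
      · simp [hi]
      · rw [Function.update_of_ne hi]
        by_contra hai
        -- An agent `i` that is still idle has at most the priority of `k`, so it cannot be
        -- outranking `k`; outranking another active agent is excluded by induction.
        have hle := hmax i (by simpa using hai)
        by_cases hj : j = k
        · subst hj
          linarith
        · rw [Function.update_of_ne hj] at haj
          exact hai (hprio i j hij haj)

lemma indexPolicy_nonneg (ν : S → ℝ) (M : ℕ) (s : Fin N → S) (a : Fin N → Fin 2) :
    0 ≤ indexPolicy ν M s a := by
  unfold indexPolicy
  split_ifs <;> positivity

lemma sum_indexPolicy (ν : S → ℝ) {M : ℕ} (hM : M ≤ N) (s : Fin N → S) :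
    ∑ a, indexPolicy ν M s a = 1 := by
  have h : ((priorityActions ν M s).card : ℝ) ≠ 0 := by
    exact_mod_cast (priorityActions_nonempty ν hM s).card_pos.ne'
  simp only [indexPolicy, Finset.sum_ite_mem, Finset.univ_inter, Finset.sum_const, nsmul_eq_mul]
  exact mul_inv_cancel₀ h

lemma comp_mem_priorityActions {ν : S → ℝ} {M : ℕ} {s : Fin N → S} {a : Fin N → Fin 2}
    (σ : Equiv.Perm (Fin N)) (hσ : ∀ i, s (σ i) = s i) (ha : a ∈ priorityActions ν M s) :
    a ∘ σ ∈ priorityActions ν M s := by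
  obtain ⟨hcard, hprio⟩ := mem_priorityActions.1 ha
  refine mem_priorityActions.2 ⟨?_, fun i j hij haj => ?_⟩
  · rw [← hcard]
    exact Finset.card_equiv σ (by simp)
  · exact hprio (σ i) (σ j) (by rwa [hσ, hσ]) haj

/-- Swapping two agents in the same state permutes the admissible actions, so uniform tie-breaking
treats them alike. -/
lemma sum_indexPolicy_active_congr {ν : S → ℝ} {M : ℕ} {s : Fin N → S} {i j : Fin N}
    (hij : s i = s j) :
    ∑ a with a i = 1, indexPolicy ν M s a = ∑ a with a j = 1, indexPolicy ν M s a := by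
  have hσ : ∀ k, s (Equiv.swap i j k) = s k := by
    intro k
    rcases eq_or_ne k i with rfl | hi
    · simp [hij]
    rcases eq_or_ne k j with rfl | hj
    · simp [hij]
    rw [Equiv.swap_apply_of_ne_of_ne hi hj]
  have hσσ : ∀ a : Fin N → Fin 2, (a ∘ Equiv.swap i j) ∘ Equiv.swap i j = a := by
    intro a
    funext k
    simp
  refine Finset.sum_nbij' (fun a => a ∘ Equiv.swap i j) (fun a => a ∘ Equiv.swap i j)
    (by simp) (by simp) (fun a _ => hσσ a) (fun a _ => hσσ a) fun a _ => ?_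
  have : a ∘ Equiv.swap i j ∈ priorityActions ν M s ↔ a ∈ priorityActions ν M s :=
    ⟨fun h => by simpa [hσσ] using comp_mem_priorityActions _ hσ h,
      comp_mem_priorityActions _ hσ⟩
  simp [indexPolicy, this]

variable [Fintype S] [DecidableEq S]

/-- The number of active agents in a local state is the one prescribed by the mean-field
description of the policy. -/
lemma card_active_eq {ν : S → ℝ} (hν : Function.Injective ν) {α : ℝ} {M : ℕ} (hN : 0 < N)
    (hM : (M : ℝ) = α * N) {s : Fin N → S} {a : Fin N → Fin 2} (ha : a ∈ priorityActions ν M s)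
    (t : S) :
    ((Finset.univ.filter fun i => s i = t ∧ a i = 1).card : ℝ) =
      N * activeMass ν α (config s) t := by
  obtain ⟨hcard, hprio⟩ := mem_priorityActions.1 ha
  have hN' : (0 : ℝ) < N := by exact_mod_cast hN
  set n : S → ℝ := fun t => ((Finset.univ.filter fun i => s i = t).card : ℝ) with hn
  set k : S → ℝ := fun t => ((Finset.univ.filter fun i => s i = t ∧ a i = 1).card : ℝ) with hk
  have hmass : N * activeMass ν α (config s) t =
      max 0 (min (n t) (M - ∑ t' with ν t < ν t', n t')) := by
    unfold activeMass
    rw [mul_max_of_nonneg _ _ hN'.le, mul_min_of_nonneg _ _ hN'.le, mul_zero, mul_sub,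
      Finset.mul_sum, hM, mul_comm α]
    simp only [natCast_mul_config hN, hn]
  rw [hmass]
  change k t = _
  have hk0 : ∀ t, 0 ≤ k t := fun t => Nat.cast_nonneg _
  have hkn : ∀ t, k t ≤ n t := fun t => by
    simp only [hk, hn, Nat.cast_le]
    exact Finset.card_le_card fun i => by simp +contextual
  have hsum : (M : ℝ) = ∑ t, k t := by
    rw [← hcard, Finset.card_eq_sum_card_fiberwise (t := (Finset.univ : Finset S)) (f := s)
      (by simp [Set.MapsTo])]
    push_cast
    refine Finset.sum_congr rfl fun t _ => ?_
    simp only [hk, Finset.filter_filter, and_comm]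
  have hsplit := sum_eq_add_sum_filter_lt hν t k
  -- An active agent in `v` forces all agents of higher priority to be active. Thus at most one
  -- state is partially active, and the clipping formula follows by locating `t` relative to it.
  have hfull : ∀ u v, ν v < ν u → 0 < k v → k u = n u := by
    intro u v huv hv
    obtain ⟨j, hj⟩ := Finset.card_pos.1 (Nat.cast_pos.1 hv)
    simp only [Finset.mem_filter, Finset.mem_univ, true_and] at hj
    simp only [hk, hn, Nat.cast_inj]
    congr 1
    refine Finset.filter_congr fun i _ => ⟨fun h => h.1, fun h => ⟨h, ?_⟩⟩
    exact hprio i j (by rw [hj.1, h]; exact huv) hj.2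
  have hlower : k t < n t → ∑ t' with ν t' < ν t, k t' = 0 := by
    intro hlt
    refine Finset.sum_eq_zero fun t' ht' => ?_
    by_contra hne
    exact hlt.ne (hfull t t' (by simpa using ht') (lt_of_le_of_ne (hk0 t') (Ne.symm hne)))
  have hlower0 : 0 ≤ ∑ t' with ν t' < ν t, k t' := Finset.sum_nonneg fun _ _ => hk0 _
  have hupper : ∑ t' with ν t < ν t', k t' ≤ ∑ t' with ν t < ν t', n t' :=
    Finset.sum_le_sum fun _ _ => hkn _
  rcases (hk0 t).eq_or_lt with h0 | h0
  · rw [← h0, max_eq_left]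
    rcases (hkn t).eq_or_lt with h1 | h1
    · exact (min_le_left _ _).trans (by rw [← h1, ← h0])
    · exact (min_le_right _ _).trans (by linarith [hlower h1])
  · have hup : ∑ t' with ν t < ν t', k t' = ∑ t' with ν t < ν t', n t' :=
      Finset.sum_congr rfl fun t' ht' => hfull t' t (by simpa using ht') h0
    rcases (hkn t).eq_or_lt with h1 | h1
    · rw [min_eq_left (by linarith), max_eq_right (by linarith), h1]
    · rw [min_eq_right (by linarith [hlower h1]), max_eq_right (by linarith [hlower h1])]
      linarith [hlower h1]

/-- Given the global state, agent `i` takes the action `b` with the probability prescribed by the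
mean-field policy in the current configuration. -/
lemma sum_indexPolicy_eq_meanFieldPolicy {ν : S → ℝ} (hν : Function.Injective ν) {α : ℝ} {M : ℕ}
    (hN : 0 < N) (hM : (M : ℝ) = α * N) (hMN : M ≤ N) (s : Fin N → S) (i : Fin N) (b : Fin 2) :
    ∑ a with a i = b, indexPolicy ν M s a = meanFieldPolicy ν α (config s) (s i) b := by
  have hN' : (0 : ℝ) < N := by exact_mod_cast hN
  have hactive : ∑ a with a i = 1, indexPolicy ν M s a =
      activeMass ν α (config s) (s i) / config s (s i) := by
    -- The expected number of active agents in the state of `i` is computed twice: it is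
    -- deterministic by `card_active_eq`, and by symmetry it is the number of such agents times the
    -- wanted marginal.
    have h1 : ∑ j with s j = s i, ∑ a with a j = 1, indexPolicy ν M s a =
        N * activeMass ν α (config s) (s i) := by
      have : ∀ a, ∑ j with s j = s i, (if a j = 1 then indexPolicy ν M s a else 0) =
          indexPolicy ν M s a * (N * activeMass ν α (config s) (s i)) := by
        intro a
        by_cases ha : a ∈ priorityActions ν M s
        · rw [← card_active_eq hν hN hM ha, ← Finset.sum_filter, Finset.filter_filter,
            Finset.sum_const, nsmul_eq_mul, mul_comm]
        · simp [indexPolicy, ha]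
      simp only [Finset.sum_filter (fun a : Fin N → Fin 2 => a _ = 1)]
      rw [Finset.sum_comm]
      simp only [this]
      rw [← Finset.sum_mul, sum_indexPolicy ν hMN, one_mul]
    have h2 : ∑ j with s j = s i, ∑ a with a j = 1, indexPolicy ν M s a =
        (N * config s (s i)) * ∑ a with a i = 1, indexPolicy ν M s a := by
      rw [natCast_mul_config hN, ← nsmul_eq_mul, ← Finset.sum_const]
      exact Finset.sum_congr rfl fun j hj => sum_indexPolicy_active_congr (by simpa using hj)
    have h3 : 0 < config s (s i) := by
      have : 0 < (Finset.univ.filter fun j => s j = s i).card :=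
        Finset.card_pos.2 ⟨i, by simp⟩
      unfold config
      positivity
    rw [eq_div_iff h3.ne']
    have := h1.symm.trans h2
    rw [mul_assoc] at this
    rw [mul_left_cancel₀ hN'.ne' this, mul_comm]
  unfold meanFieldPolicy
  split_ifs with hb
  · rw [hb, hactive]
  · have hb0 : b = 0 := by omega
    rw [← hactive, ← sum_indexPolicy ν hMN s,
      ← Finset.sum_filter_add_sum_filter_not Finset.univ (fun a : Fin N → Fin 2 => a i = 1)
        (indexPolicy ν M s), add_sub_cancel_left, hb0]
    refine Finset.sum_congr (Finset.filter_congr fun a _ => ?_) fun _ _ => rfl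
    omega

end Policy
-- Lipschitz bounds for the mean-field dynamics
section MeanField

variable {S : Type*} [Fintype S]

/-- The budget left over for the local state `t` by the states of higher priority. -/
noncomputable def remainingBudget (ν : S → ℝ) (α : ℝ) (m : S → ℝ) (t : S) : ℝ :=
  α - ∑ s' with ν t < ν s', m s'

lemma activeMass_eq (ν : S → ℝ) (α : ℝ) (m : S → ℝ) (t : S) :
    activeMass ν α m t = max 0 (min (m t) (remainingBudget ν α m t)) := rfl

lemma activeMass_nonneg (ν : S → ℝ) (α : ℝ) (m : S → ℝ) (t : S) : 0 ≤ activeMass ν α m t :=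
  le_max_left _ _

lemma activeMass_le {ν : S → ℝ} {α : ℝ} {m : S → ℝ} {t : S} (hm : 0 ≤ m t) :
    activeMass ν α m t ≤ m t :=
  max_le hm (min_le_left _ _)

lemma mul_activeMass_div {ν : S → ℝ} {α : ℝ} {m : S → ℝ} {t : S} (hm : 0 ≤ m t) :
    m t * (activeMass ν α m t / m t) = activeMass ν α m t := by
  rcases eq_or_ne (m t) 0 with h | h
  · have h1 := activeMass_le (ν := ν) (α := α) hm
    have h2 := activeMass_nonneg ν α m t
    rw [h, zero_mul]
    linarith
  · field_simp

lemma abs_sub_apply_le (m m' : S → ℝ) (t : S) : |m t - m' t| ≤ ‖m - m'‖ :=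
  norm_le_pi_norm (m - m') t

lemma abs_remainingBudget_sub_le (ν : S → ℝ) (α : ℝ) (m m' : S → ℝ) (t : S) :
    |remainingBudget ν α m t - remainingBudget ν α m' t| ≤ Fintype.card S * ‖m - m'‖ := by
  unfold remainingBudget
  rw [sub_sub_sub_cancel_left, ← Finset.sum_sub_distrib]
  calc _ ≤ ∑ s' with ν t < ν s', |m' s' - m s'| := Finset.abs_sum_le_sum_abs _ _
    _ ≤ ∑ s', |m' s' - m s'| :=
        Finset.sum_le_sum_of_subset_of_nonneg (Finset.filter_subset _ _) fun _ _ _ => abs_nonneg _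
    _ ≤ ∑ _s' : S, ‖m - m'‖ := Finset.sum_le_sum fun s' _ => by
        rw [abs_sub_comm]
        exact abs_sub_apply_le m m' s'
    _ = _ := by simp

lemma one_le_card_of_elem (t : S) : (1 : ℝ) ≤ Fintype.card S := by
  have := Fintype.card_pos_iff.2 ⟨t⟩
  exact_mod_cast this

lemma abs_activeMass_sub_le (ν : S → ℝ) (α : ℝ) (m m' : S → ℝ) (t : S) :
    |activeMass ν α m t - activeMass ν α m' t| ≤ Fintype.card S * ‖m - m'‖ := by
  rw [activeMass_eq, activeMass_eq]
  refine (abs_max_sub_max_le_max _ _ _ _).trans (max_le (by simp; positivity) ?_)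
  refine (abs_min_sub_min_le_max _ _ _ _).trans (max_le ?_ (abs_remainingBudget_sub_le ..))
  exact (abs_sub_apply_le m m' t).trans
    (le_mul_of_one_le_left (norm_nonneg _) (one_le_card_of_elem t))

lemma configMap_apply {P : Fin 2 → Matrix S S ℝ} {ν : S → ℝ} {α : ℝ} {m : S → ℝ}
    (hm : ∀ s, 0 ≤ m s) (t : S) :
    configMap P ν α m t = ∑ s, ((m s - activeMass ν α m s) * P 0 s t +
      activeMass ν α m s * P 1 s t) := by
  unfold configMap
  refine Finset.sum_congr rfl fun s _ => ?_
  rw [Fin.sum_univ_two]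
  simp only [meanFieldPolicy, zero_ne_one, if_true, if_false, mul_sub, mul_one,
    mul_activeMass_div (hm s)]

/-- The policy is Lipschitz once it is weighted with the configuration. -/
lemma mul_abs_meanFieldPolicy_sub_le {ν : S → ℝ} {α : ℝ} {m m' : S → ℝ}
    {t : S} (hm : 0 ≤ m t) (hm' : 0 ≤ m' t) (b : Fin 2) :
    m t * |meanFieldPolicy ν α m t b - meanFieldPolicy ν α m' t b| ≤
      (Fintype.card S + 1) * ‖m - m'‖ := by
  have hq0 : 0 ≤ activeMass ν α m' t / m' t := div_nonneg (activeMass_nonneg _ _ _ _) hm'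
  have hq1 : activeMass ν α m' t / m' t ≤ 1 := div_le_one_of_le₀ (activeMass_le hm') hm'
  have hb : |meanFieldPolicy ν α m t b - meanFieldPolicy ν α m' t b| =
      |activeMass ν α m t / m t - activeMass ν α m' t / m' t| := by
    unfold meanFieldPolicy
    split_ifs
    · rfl
    · rw [sub_sub_sub_cancel_left, abs_sub_comm]
  rw [hb, ← abs_of_nonneg hm, ← abs_mul, abs_of_nonneg hm, mul_sub, mul_activeMass_div hm]
  have h1 := mul_activeMass_div (ν := ν) (α := α) hm'
  -- The quotient alone is not Lipschitz near zero mass. Weighted by `m t`, only the Lipschitz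
  -- active mass and a bounded multiple of `m t - m' t` remain.
  have h2 : activeMass ν α m t - m t * (activeMass ν α m' t / m' t) =
      (activeMass ν α m t - activeMass ν α m' t) -
        (m t - m' t) * (activeMass ν α m' t / m' t) := by
    linear_combination -h1
  rw [h2, add_mul, one_mul]
  refine (abs_sub _ _).trans (add_le_add (abs_activeMass_sub_le ..) ?_)
  rw [abs_mul, abs_of_nonneg hq0]
  exact (mul_le_of_le_one_right (abs_nonneg _) hq1).trans (abs_sub_apply_le m m' t)

/-- A Lipschitz constant of the configuration map on the simplex. -/
noncomputable def configMapLip (S : Type*) [Fintype S] : ℝ :=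
  Fintype.card S * (2 * Fintype.card S + 1)

lemma configMapLip_nonneg : 0 ≤ configMapLip S := by
  unfold configMapLip
  positivity

lemma one_le_configMapLip (t : S) : 1 ≤ configMapLip S := by
  unfold configMapLip
  nlinarith [one_le_card_of_elem t]

variable [DecidableEq S] {P : Fin 2 → Matrix S S ℝ}

lemma configMap_mem_stdSimplex (hP : ∀ a, P a ∈ Matrix.rowStochastic ℝ S) {ν : S → ℝ} {α : ℝ}
    {m : S → ℝ} (hm : m ∈ stdSimplex ℝ S) : configMap P ν α m ∈ stdSimplex ℝ S := by
  have hP' := fun a => Matrix.mem_rowStochastic_iff_sum.1 (hP a)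
  refine ⟨fun t => ?_, ?_⟩
  · rw [configMap_apply hm.1]
    exact Finset.sum_nonneg fun s _ => add_nonneg
      (mul_nonneg (sub_nonneg.2 (activeMass_le (hm.1 s))) ((hP' 0).1 s t))
      (mul_nonneg (activeMass_nonneg _ _ _ _) ((hP' 1).1 s t))
  · simp only [configMap_apply hm.1]
    rw [Finset.sum_comm, ← hm.2]
    refine Finset.sum_congr rfl fun s _ => ?_
    rw [Finset.sum_add_distrib, ← Finset.mul_sum, ← Finset.mul_sum, (hP' 0).2, (hP' 1).2]
    ring

lemma iterate_configMap_mem_stdSimplex (hP : ∀ a, P a ∈ Matrix.rowStochastic ℝ S) {ν : S → ℝ}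
    {α : ℝ} {m : S → ℝ} (hm : m ∈ stdSimplex ℝ S) (t : ℕ) :
    (configMap P ν α)^[t] m ∈ stdSimplex ℝ S := by
  induction t with
  | zero => exact hm
  | succ t ih =>
    rw [Function.iterate_succ_apply']
    exact configMap_mem_stdSimplex hP ih

lemma entry_le_one_of_rowStochastic {A : Matrix S S ℝ}
    (hA : A ∈ Matrix.rowStochastic ℝ S) (s t : S) : A s t ≤ 1 := by
  have h := Matrix.mem_rowStochastic_iff_sum.1 hA
  rw [← h.2 s]
  exact Finset.single_le_sum (f := fun t => A s t) (fun t _ => h.1 s t) (Finset.mem_univ t)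

lemma norm_configMap_sub_le (hP : ∀ a, P a ∈ Matrix.rowStochastic ℝ S) (ν : S → ℝ) (α : ℝ)
    {m m' : S → ℝ} (hm : ∀ s, 0 ≤ m s) (hm' : ∀ s, 0 ≤ m' s) :
    ‖configMap P ν α m - configMap P ν α m'‖ ≤ configMapLip S * ‖m - m'‖ := by
  have hP' := fun a => Matrix.mem_rowStochastic_iff_sum.1 (hP a)
  refine (pi_norm_le_iff_of_nonneg (mul_nonneg configMapLip_nonneg (norm_nonneg _))).2 fun t => ?_
  rw [Pi.sub_apply, configMap_apply hm, configMap_apply hm', ← Finset.sum_sub_distrib]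
  -- The active mass occurs in both the idle and the activated flow, hence the `2`; the mass itself
  -- contributes the `1`.
  have hterm : ∀ s, |((m s - activeMass ν α m s) * P 0 s t + activeMass ν α m s * P 1 s t) -
      ((m' s - activeMass ν α m' s) * P 0 s t + activeMass ν α m' s * P 1 s t)| ≤
      (2 * Fintype.card S + 1) * ‖m - m'‖ := by
    intro s
    set x := activeMass ν α m s
    set x' := activeMass ν α m' s
    have hx : |x - x'| ≤ Fintype.card S * ‖m - m'‖ := abs_activeMass_sub_le ν α m m' s
    have hs := abs_sub_apply_le m m' s
    have hmul : ∀ c a, |c * P a s t| ≤ |c| := fun c a => by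
      rw [abs_mul, abs_of_nonneg ((hP' a).1 s t)]
      exact mul_le_of_le_one_right (abs_nonneg _) (entry_le_one_of_rowStochastic (hP a) s t)
    have hsplit : ((m s - x) * P 0 s t + x * P 1 s t) -
        ((m' s - x') * P 0 s t + x' * P 1 s t) =
        (m s - m' s) * P 0 s t - (x - x') * P 0 s t + (x - x') * P 1 s t := by ring
    rw [hsplit]
    calc _ ≤ |(m s - m' s) * P 0 s t - (x - x') * P 0 s t| + |(x - x') * P 1 s t| :=
          abs_add_le _ _
      _ ≤ (|(m s - m' s) * P 0 s t| + |(x - x') * P 0 s t|) + |(x - x') * P 1 s t| := by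
          gcongr
          exact abs_sub _ _
      _ ≤ (|m s - m' s| + |x - x'|) + |x - x'| := by
          exact add_le_add (add_le_add (hmul _ _) (hmul _ _)) (hmul _ _)
      _ ≤ _ := by linarith
  calc _ ≤ ∑ _s : S, (2 * Fintype.card S + 1) * ‖m - m'‖ :=
        (Finset.abs_sum_le_sum_abs _ _).trans (Finset.sum_le_sum fun s _ => hterm s)
    _ = configMapLip S * ‖m - m'‖ := by
        unfold configMapLip
        simp [mul_assoc]

lemma norm_iterate_configMap_sub_le (hP : ∀ a, P a ∈ Matrix.rowStochastic ℝ S) (ν : S → ℝ) (α : ℝ)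
    {m m' : S → ℝ} (hm : m ∈ stdSimplex ℝ S) (hm' : m' ∈ stdSimplex ℝ S) (t : ℕ) :
    ‖(configMap P ν α)^[t] m - (configMap P ν α)^[t] m'‖ ≤ configMapLip S ^ t * ‖m - m'‖ := by
  induction t with
  | zero => simp
  | succ t ih =>
    rw [Function.iterate_succ_apply', Function.iterate_succ_apply', pow_succ', mul_assoc]
    exact (norm_configMap_sub_le hP ν α (iterate_configMap_mem_stdSimplex hP hm t).1
      (iterate_configMap_mem_stdSimplex hP hm' t).1).trans
      (mul_le_mul_of_nonneg_left ih configMapLip_nonneg)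

/-- Two consecutive late iterates are both near `mstar`, and continuity of the map identifies their
limit as a fixed point. -/
lemma UGAP.configMap_eq (hP : ∀ a, P a ∈ Matrix.rowStochastic ℝ S) {ν : S → ℝ} {α : ℝ}
    {mstar : S → ℝ} (h : UGAP P ν α mstar) : configMap P ν α mstar = mstar := by
  obtain ⟨hmem, hconv⟩ := h
  rw [← sub_eq_zero, ← norm_le_zero_iff]
  refine le_of_forall_pos_le_add fun ε hε => ?_
  have hL := configMapLip_nonneg (S := S)
  obtain ⟨T, hT⟩ := hconv (ε / (configMapLip S + 1)) (by positivity)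
  have h1 := hT T le_rfl mstar hmem
  have h2 := hT (T + 1) (by omega) mstar hmem
  rw [Function.iterate_succ_apply'] at h2
  set m := (configMap P ν α)^[T] mstar with hm
  have h3 := norm_configMap_sub_le hP ν α hmem.1
    (iterate_configMap_mem_stdSimplex hP (ν := ν) (α := α) hmem T).1
  rw [← hm, norm_sub_rev mstar] at h3
  calc ‖configMap P ν α mstar - mstar‖
      ≤ ‖configMap P ν α mstar - configMap P ν α m‖ + ‖configMap P ν α m - mstar‖ :=
        norm_sub_le_norm_sub_add_norm_sub _ _ _
    _ ≤ configMapLip S * (ε / (configMapLip S + 1)) + ε / (configMapLip S + 1) := by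
        gcongr
        exact h3.trans (by gcongr)
    _ = 0 + ε := by field_simp; ring

end MeanField

/-! ### Affine behaviour near the attractor and contraction -/

section LocalContraction

variable {S : Type*} [Fintype S]

/-- The configurations in which the budget is exhausted inside the local state `s₀`. -/
def criticalRegion (ν : S → ℝ) (α : ℝ) (s₀ : S) : Set (S → ℝ) :=
  {m | (∀ s, 0 ≤ m s) ∧ 0 < remainingBudget ν α m s₀ ∧ remainingBudget ν α m s₀ < m s₀}

lemma remainingBudget_combo (ν : S → ℝ) (α : ℝ) (m m' : S → ℝ) (θ : ℝ) (t : S) :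
    remainingBudget ν α ((1 - θ) • m + θ • m') t =
      (1 - θ) * remainingBudget ν α m t + θ * remainingBudget ν α m' t := by
  simp only [remainingBudget, Pi.add_apply, Pi.smul_apply, smul_eq_mul, Finset.sum_add_distrib,
    ← Finset.mul_sum]
  ring

/-- The region is cut out by inequalities affine in `m`, hence convex. -/
lemma combo_mem_criticalRegion {ν : S → ℝ} {α : ℝ} {s₀ : S} {m m' : S → ℝ}
    (hm : m ∈ criticalRegion ν α s₀) (hm' : m' ∈ criticalRegion ν α s₀) {θ : ℝ} (h0 : 0 ≤ θ)
    (h1 : θ ≤ 1) : (1 - θ) • m + θ • m' ∈ criticalRegion ν α s₀ := by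
  have key : ∀ a b : ℝ, 0 < a → 0 < b → 0 < (1 - θ) * a + θ * b := by
    intro a b ha hb
    rcases h0.eq_or_lt with rfl | h
    · simpa
    · exact add_pos_of_nonneg_of_pos (mul_nonneg (by linarith) ha.le) (mul_pos h hb)
  refine ⟨fun s => ?_, ?_, ?_⟩
  · exact add_nonneg (mul_nonneg (by linarith) (hm.1 s)) (mul_nonneg h0 (hm'.1 s))
  · rw [remainingBudget_combo]
    exact key _ _ hm.2.1 hm'.2.1
  · rw [remainingBudget_combo]
    have := key _ _ (sub_pos.2 hm.2.2) (sub_pos.2 hm'.2.2)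
    simp only [Pi.add_apply, Pi.smul_apply, smul_eq_mul]
    linarith

/-- States above `s₀` are fully active, those below are idle, and `s₀` absorbs the rest. With this
pattern fixed, the active mass is affine in `m`. -/
lemma activeMass_of_mem_criticalRegion {ν : S → ℝ} (hν : Function.Injective ν) {α : ℝ} {s₀ : S}
    {m : S → ℝ} (hm : m ∈ criticalRegion ν α s₀) (t : S) :
    activeMass ν α m t = if ν s₀ < ν t then m t else
      if ν t < ν s₀ then 0 else remainingBudget ν α m s₀ := by
  classical
  obtain ⟨h0, h1, h2⟩ := hm
  have hmono : ∀ u v, ν u < ν v →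
      ∑ s' with ν v < ν s', m s' + m v ≤ ∑ s' with ν u < ν s', m s' := by
    intro u v huv
    rw [add_comm, ← Finset.sum_insert (by simp)]
    refine Finset.sum_le_sum_of_subset_of_nonneg (fun s' hs' => ?_) fun s' _ _ => h0 s'
    rcases Finset.mem_insert.1 hs' with rfl | h
    · simpa using huv
    · have := (Finset.mem_filter.1 h).2
      simpa using huv.trans this
  rw [activeMass_eq]
  unfold remainingBudget at h1 h2 ⊢
  split_ifs with hlt hgt
  · have := hmono _ _ hlt
    rw [min_eq_left (by linarith), max_eq_right (h0 t)]
  · have := hmono _ _ hgt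
    exact max_eq_left ((min_le_right _ _).trans (by linarith))
  · rw [hν (le_antisymm (not_lt.1 hlt) (not_lt.1 hgt))]
    rw [min_eq_right h2.le, max_eq_right h1.le]

lemma configMap_combo {P : Fin 2 → Matrix S S ℝ} {ν : S → ℝ} (hν : Function.Injective ν) {α : ℝ}
    {s₀ : S} {m m' : S → ℝ} (hm : m ∈ criticalRegion ν α s₀) (hm' : m' ∈ criticalRegion ν α s₀)
    {θ : ℝ} (h0 : 0 ≤ θ) (h1 : θ ≤ 1) :
    configMap P ν α ((1 - θ) • m + θ • m') =
      (1 - θ) • configMap P ν α m + θ • configMap P ν α m' := by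
  have hc := combo_mem_criticalRegion hm hm' h0 h1
  have hx : ∀ s, activeMass ν α ((1 - θ) • m + θ • m') s =
      (1 - θ) * activeMass ν α m s + θ * activeMass ν α m' s := by
    intro s
    rw [activeMass_of_mem_criticalRegion hν hc, activeMass_of_mem_criticalRegion hν hm,
      activeMass_of_mem_criticalRegion hν hm', remainingBudget_combo]
    split_ifs <;> simp
  funext t
  simp only [Pi.add_apply, Pi.smul_apply, smul_eq_mul]
  rw [configMap_apply hc.1, configMap_apply hm.1, configMap_apply hm'.1, Finset.mul_sum,
    Finset.mul_sum, ← Finset.sum_add_distrib]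
  refine Finset.sum_congr rfl fun s _ => ?_
  rw [hx]
  simp only [Pi.add_apply, Pi.smul_apply, smul_eq_mul]
  ring

/-- It is enough that the orbit of the far endpoint `m'` stays in the region: by convexity the whole
segment to the fixed point then does. -/
lemma iterate_configMap_combo {P : Fin 2 → Matrix S S ℝ} {ν : S → ℝ} (hν : Function.Injective ν)
    {α : ℝ} {s₀ : S} {m m' : S → ℝ} (hm : m ∈ criticalRegion ν α s₀)
    (hfix : configMap P ν α m = m)
    (hm' : ∀ t, (configMap P ν α)^[t] m' ∈ criticalRegion ν α s₀) {θ : ℝ} (h0 : 0 ≤ θ)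
    (h1 : θ ≤ 1) (t : ℕ) :
    (configMap P ν α)^[t] ((1 - θ) • m + θ • m') =
      (1 - θ) • m + θ • (configMap P ν α)^[t] m' := by
  induction t with
  | zero => rfl
  | succ t ih =>
    rw [Function.iterate_succ_apply', ih, configMap_combo hν hm (hm' t) h0 h1, hfix,
      Function.iterate_succ_apply']

lemma NonDegenerate.exists_mem_criticalRegion {ν : S → ℝ} {α : ℝ} {mstar : S → ℝ}
    (h : NonDegenerate ν α mstar) (hm : ∀ s, 0 ≤ mstar s) :
    ∃ s₀, mstar ∈ criticalRegion ν α s₀ := by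
  obtain ⟨s₀, h0, h1⟩ := h
  simp only [meanFieldPolicy, zero_ne_one, if_false] at h0 h1
  have hpos : 0 < activeMass ν α mstar s₀ / mstar s₀ := by linarith
  have hlt : activeMass ν α mstar s₀ / mstar s₀ < 1 := by linarith
  -- At zero mass, division by zero would make the activation probability vanish.
  have hm0 : 0 < mstar s₀ := by
    rcases (hm s₀).eq_or_lt with h | h
    · simp [← h] at hpos
    · exact h
  rw [div_lt_one hm0] at hlt
  rw [div_pos_iff_of_pos_right hm0] at hpos
  rw [activeMass_eq] at hpos hlt
  have hmin : 0 < min (mstar s₀) (remainingBudget ν α mstar s₀) := by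
    rcases lt_max_iff.1 hpos with h | h
    · exact absurd h (lt_irrefl _)
    · exact h
  refine ⟨s₀, hm, (lt_min_iff.1 hmin).2, ?_⟩
  rw [max_eq_right hmin.le] at hlt
  rcases min_lt_iff.1 hlt with h | h
  · exact absurd h (lt_irrefl _)
  · exact h

lemma exists_ball_subset_criticalRegion {ν : S → ℝ} {α : ℝ} {s₀ : S} {mstar : S → ℝ}
    (h : mstar ∈ criticalRegion ν α s₀) :
    ∃ δ > 0, ∀ m : S → ℝ, (∀ s, 0 ≤ m s) → ‖m - mstar‖ < δ → m ∈ criticalRegion ν α s₀ := by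
  obtain ⟨-, h1, h2⟩ := h
  have hc : (0 : ℝ) < Fintype.card S + 1 := by positivity
  refine ⟨min (remainingBudget ν α mstar s₀) (mstar s₀ - remainingBudget ν α mstar s₀) /
    (Fintype.card S + 1), div_pos (lt_min h1 (sub_pos.2 h2)) hc, fun m hm hd => ?_⟩
  rw [lt_div_iff₀ hc, lt_min_iff] at hd
  have hb := abs_le.1 (abs_remainingBudget_sub_le ν α m mstar s₀)
  have hs := abs_le.1 (abs_sub_apply_le m mstar s₀)
  have hn := norm_nonneg (m - mstar)
  exact ⟨hm, by linarith [hd.1], by linarith [hd.2]⟩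

/-- Used to push a point away from `mstar` without making a positive coordinate negative. -/
lemma exists_pos_le_of_pos [Nonempty S] (m : S → ℝ) : ∃ ρ > 0, ∀ s, 0 < m s → ρ ≤ m s := by
  classical
  obtain ⟨s₁, hs₁⟩ := Finite.exists_min fun s => if 0 < m s then m s else 1
  refine ⟨if 0 < m s₁ then m s₁ else 1, by split_ifs <;> simp_all, fun s hs => ?_⟩
  have := hs₁ s
  simpa [hs] using this

variable [DecidableEq S] {P : Fin 2 → Matrix S S ℝ}

/-- Some iterate of the configuration map contracts the simplex towards the attractor.  Near the
attractor the map is affine, so that the uniform convergence can be scaled down. -/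
lemma exists_iterate_contraction (hP : ∀ a, P a ∈ Matrix.rowStochastic ℝ S) {ν : S → ℝ}
    (hν : Function.Injective ν) {α : ℝ} {mstar : S → ℝ} (hnd : NonDegenerate ν α mstar)
    (h : UGAP P ν α mstar) :
    ∃ T : ℕ, ∀ m ∈ stdSimplex ℝ S,
      ‖(configMap P ν α)^[T] m - mstar‖ ≤ ‖m - mstar‖ / 2 := by
  have hfix := h.configMap_eq hP
  obtain ⟨hmem, hconv⟩ := h
  obtain ⟨s₀, hs₀⟩ := hnd.exists_mem_criticalRegion hmem.1
  have : Nonempty S := ⟨s₀⟩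
  obtain ⟨δ, hδ, hball⟩ := exists_ball_subset_criticalRegion hs₀
  obtain ⟨ρ, hρ, hρm⟩ := exists_pos_le_of_pos mstar
  obtain ⟨T₀, hT₀⟩ := hconv δ hδ
  have hL := one_le_configMapLip s₀
  have hL0 : 0 < configMapLip S := by linarith
  have hLT : 0 < configMapLip S ^ T₀ := by positivity
  -- The bound by `ρ` keeps rescaled points nonnegative. The second bound controls the first `T₀`
  -- iterates through the Lipschitz constant; after time `T₀`, UGAP does.
  set η := min ρ (δ / (2 * configMapLip S ^ T₀)) with hη
  have hη0 : 0 < η := lt_min hρ (by positivity)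
  have hstay : ∀ m ∈ stdSimplex ℝ S, ‖m - mstar‖ ≤ η →
      ∀ t, (configMap P ν α)^[t] m ∈ criticalRegion ν α s₀ := by
    intro m hm hmη t
    refine hball _ (iterate_configMap_mem_stdSimplex hP hm t).1 ?_
    rcases le_or_gt T₀ t with ht | ht
    · exact hT₀ t ht m hm
    · have h1 := norm_iterate_configMap_sub_le hP ν α hm hmem t
      rw [Function.iterate_fixed hfix] at h1
      calc _ ≤ configMapLip S ^ t * ‖m - mstar‖ := h1
        _ ≤ configMapLip S ^ T₀ * (δ / (2 * configMapLip S ^ T₀)) := by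
            gcongr
            exact hmη.trans (min_le_right _ _)
        _ = δ / 2 := by field_simp
        _ < δ := by linarith
  obtain ⟨T, hT⟩ := hconv (η / 2) (by positivity)
  refine ⟨T, fun m hm => ?_⟩
  -- Far away, being within `η / 2` at time `T` is already a halving. Close by, the estimate is
  -- transported from the sphere of radius `η`.
  rcases le_or_gt η ‖m - mstar‖ with hfar | hnear
  · linarith [hT T le_rfl m hm]
  rcases eq_or_ne m mstar with rfl | hne
  · simp [Function.iterate_fixed hfix]
  set d := ‖m - mstar‖ with hd
  have hd0 : 0 < d := norm_pos_iff.2 (sub_ne_zero.2 hne)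
  -- The point at distance exactly `η` on the ray from `mstar` through `m`.
  set m' : S → ℝ := mstar + (η / d) • (m - mstar) with hm'
  have hm'sub : m' - mstar = (η / d) • (m - mstar) := by simp [hm']
  have hm'norm : ‖m' - mstar‖ = η := by
    rw [hm'sub, norm_smul, Real.norm_of_nonneg (by positivity), ← hd]
    field_simp
  have hm'mem : m' ∈ stdSimplex ℝ S := by
    refine ⟨fun s => ?_, ?_⟩
    · rcases (hmem.1 s).eq_or_lt with hz | hz
      · have : m' s = (η / d) * m s := by simp [hm', ← hz]
        rw [this]
        exact mul_nonneg (by positivity) (hm.1 s)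
      · have h1 := (abs_le.1 (abs_sub_apply_le m' mstar s)).1
        rw [hm'norm] at h1
        have h2 := hρm s hz
        have h3 : η ≤ ρ := min_le_left _ _
        linarith
    · simp only [hm', Pi.add_apply, Pi.smul_apply, Pi.sub_apply, smul_eq_mul,
        Finset.sum_add_distrib, ← Finset.mul_sum, Finset.sum_sub_distrib, hm.2, hmem.2]
      ring
  have hcombo : m = (1 - d / η) • mstar + (d / η) • m' := by
    funext s
    simp only [hm', Pi.add_apply, Pi.smul_apply, Pi.sub_apply, smul_eq_mul]
    field_simp
    ring
  have hθ1 : d / η ≤ 1 := (div_le_one hη0).2 hnear.le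
  have hit := iterate_configMap_combo (P := P) hν hs₀ hfix (hstay m' hm'mem hm'norm.le)
    (by positivity) hθ1 T
  rw [← hcombo] at hit
  have hdiff : (configMap P ν α)^[T] m - mstar =
      (d / η) • ((configMap P ν α)^[T] m' - mstar) := by
    rw [hit, smul_sub, sub_smul, one_smul]
    abel
  rw [hdiff, norm_smul, Real.norm_of_nonneg (by positivity)]
  calc d / η * ‖(configMap P ν α)^[T] m' - mstar‖ ≤ d / η * (η / 2) := by
        gcongr
        exact (hT T le_rfl m' hm'mem).le
    _ = d / 2 := by field_simp

end LocalContraction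
-- One-step concentration of the configuration
section Concentration

variable {S : Type*} {P : Fin 2 → Matrix S S ℝ} {N : ℕ}

lemma globalKernel_nonneg (hP0 : ∀ a s t, 0 ≤ P a s t) (s : Fin N → S) (a : Fin N → Fin 2)
    (s' : Fin N → S) : 0 ≤ globalKernel P s a s' :=
  Finset.prod_nonneg fun _ _ => hP0 _ _ _

variable [Fintype S]

lemma sum_globalKernel (hP1 : ∀ a s, ∑ t, P a s t = 1) (s : Fin N → S) (a : Fin N → Fin 2) :
    ∑ s', globalKernel P s a s' = 1 :=
  sum_prod_eq_one fun _ => hP1 _ _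

variable [DecidableEq S]

/-- The expected next configuration is given by the configuration map. -/
lemma sum_kernel_apply_eq {ν : S → ℝ} (hν : Function.Injective ν) {α : ℝ} {M : ℕ} (hN : 0 < N)
    (hM : (M : ℝ) = α * N) {s : Fin N → S} {a : Fin N → Fin 2} (ha : a ∈ priorityActions ν M s)
    (t : S) : ∑ i, P (a i) (s i) t = N * configMap P ν α (config s) t := by
  rw [configMap_apply (config_mem_stdSimplex hN s).1, Finset.mul_sum,
    ← Finset.sum_fiberwise Finset.univ s]
  refine Finset.sum_congr rfl fun u _ => ?_
  rw [mul_add, ← mul_assoc, ← mul_assoc, mul_sub, ← card_active_eq hν hN hM ha,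
    natCast_mul_config hN]
  have hcard : ((Finset.univ.filter fun i => s i = u).card : ℝ) -
      ((Finset.univ.filter fun i => s i = u ∧ a i = 1).card : ℝ) =
      ((Finset.univ.filter fun i => s i = u ∧ ¬ a i = 1).card : ℝ) := by
    rw [sub_eq_iff_eq_add', ← Finset.filter_filter, ← Finset.filter_filter]
    exact_mod_cast (Finset.card_filter_add_card_filter_not _).symm
  rw [hcard, ← Finset.sum_filter_add_sum_filter_not _ (fun i => a i = 1), Finset.filter_filter,
    Finset.filter_filter, add_comm, ← nsmul_eq_mul, ← nsmul_eq_mul, ← Finset.sum_const,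
    ← Finset.sum_const]
  congr 1 <;> refine Finset.sum_congr rfl fun i hi => ?_
  · simp only [Finset.mem_filter, Finset.mem_univ, true_and] at hi
    have : a i = 0 := by omega
    rw [this, hi.1]
  · simp only [Finset.mem_filter, Finset.mem_univ, true_and] at hi
    rw [hi.2, hi.1]

/-- The next configuration concentrates around its expectation. -/
lemma sum_globalKernel_mul_norm_le (hP : ∀ a, P a ∈ Matrix.rowStochastic ℝ S) {ν : S → ℝ}
    (hν : Function.Injective ν) {α : ℝ} {M : ℕ} (hN : 0 < N) (hM : (M : ℝ) = α * N)
    {s : Fin N → S} {a : Fin N → Fin 2} (ha : a ∈ priorityActions ν M s) :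
    ∑ s', globalKernel P s a s' * ‖config s' - configMap P ν α (config s)‖ ≤
      Fintype.card S / √N := by
  have hP' := fun a => Matrix.mem_rowStochastic_iff_sum.1 (hP a)
  have hN' : (0 : ℝ) < N := by exact_mod_cast hN
  set φ := configMap P ν α (config s)
  have hcoord : ∀ t, ∑ s', globalKernel P s a s' * |config s' t - φ t| ≤ 1 / √N := by
    intro t
    -- Centred indicators of agent `i` landing in `t`; their sum is `N` times the deviation of the
    -- configuration.
    set h : Fin N → S → ℝ := fun i t' => (if t' = t then 1 else 0) - P (a i) (s i) t with hh
    have hsum : ∀ s' : Fin N → S, ∑ i, h i (s' i) = N * (config s' t - φ t) := by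
      intro s'
      rw [mul_sub, natCast_mul_config hN, ← sum_kernel_apply_eq hν hN hM ha]
      simp only [hh, Finset.sum_sub_distrib, Finset.sum_boole]
    have hmain := sum_prod_mul_abs_le (p := fun i t' => P (a i) (s i) t') (h := h)
      (fun i t' => (hP' _).1 _ _) (fun i => (hP' _).2 _)
      (fun i t' => by
        have h0 := (hP' (a i)).1 (s i) t
        have h1 := entry_le_one_of_rowStochastic (hP (a i)) (s i) t
        simp only [hh]
        rw [abs_le]
        split_ifs <;> constructor <;> linarith)
      (fun i => by
        simp only [hh, mul_sub, Finset.sum_sub_distrib, ← Finset.sum_mul, (hP' (a i)).2]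
        simp) hN
    simp only [hsum, abs_mul, abs_of_pos hN'] at hmain
    have hrw : ∑ s' : Fin N → S, (∏ i, P (a i) (s i) (s' i)) * (N * |config s' t - φ t|) =
        N * ∑ s', globalKernel P s a s' * |config s' t - φ t| := by
      rw [Finset.mul_sum]
      exact Finset.sum_congr rfl fun s' _ => by unfold globalKernel; ring
    rw [hrw] at hmain
    have hsq : √(N : ℝ) * √N = N := Real.mul_self_sqrt hN'.le
    have hpos : 0 < √(N : ℝ) := Real.sqrt_pos.2 hN'
    rw [le_div_iff₀ hpos]
    nlinarith
  calc _ ≤ ∑ s', globalKernel P s a s' * ∑ t, |config s' t - φ t| := by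
        refine Finset.sum_le_sum fun s' _ => mul_le_mul_of_nonneg_left ?_
          (globalKernel_nonneg (fun a => (hP' a).1) _ _ _)
        refine (pi_norm_le_iff_of_nonneg (Finset.sum_nonneg fun _ _ => abs_nonneg _)).2 fun t => ?_
        exact Finset.single_le_sum (f := fun t => |config s' t - φ t|)
          (fun _ _ => abs_nonneg _) (Finset.mem_univ t)
    _ = ∑ t, ∑ s', globalKernel P s a s' * |config s' t - φ t| := by
        simp only [Finset.mul_sum]
        exact Finset.sum_comm
    _ ≤ ∑ _t : S, 1 / √N := Finset.sum_le_sum fun t _ => hcoord t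
    _ = Fintype.card S / √N := by simp [div_eq_mul_inv]

end Concentration

/-! ### Stationary distance from the attractor -/

section Stationary

variable {S : Type*} {P : Fin 2 → Matrix S S ℝ} {N : ℕ}
  {π : (Fin N → S) → (Fin N → Fin 2) → ℝ} {μ : (Fin N → S) → ℝ}

lemma pairTransition_nonneg (hP0 : ∀ a s t, 0 ≤ P a s t) (hπ0 : ∀ s a, 0 ≤ π s a)
    (x y : Pair S N) : 0 ≤ pairTransition P π x y :=
  mul_nonneg (globalKernel_nonneg hP0 _ _ _) (hπ0 _ _)

variable [Fintype S]

lemma sum_pairTransition (hP1 : ∀ a s, ∑ t, P a s t = 1) (hπ : ∀ s, ∑ a, π s a = 1)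
    (x : Pair S N) : ∑ y, pairTransition P π x y = 1 := by
  rw [Fintype.sum_prod_type]
  simp only [pairTransition, ← Finset.mul_sum, hπ, mul_one]
  exact sum_globalKernel hP1 _ _

lemma sum_occupancy_mul_fst (hπ : ∀ s, ∑ a, π s a = 1) (f : (Fin N → S) → ℝ) :
    ∑ x : Pair S N, occupancy π μ x * f x.1 = ∑ s, μ s * f s := by
  rw [Fintype.sum_prod_type]
  refine Finset.sum_congr rfl fun s _ => ?_
  simp only [occupancy, ← Finset.sum_mul, ← Finset.mul_sum, hπ, mul_one]

lemma IsStationary.apply_eq (h : IsStationary P π μ) (s' : Fin N → S) :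
    ∑ x, occupancy π μ x * globalKernel P x.1 x.2 s' = μ s' := by
  rw [Fintype.sum_prod_type]
  conv_rhs => rw [← h.2]
  simp only [Matrix.vecMul, dotProduct, stateTransition, occupancy, Finset.mul_sum, mul_assoc]

lemma IsStationary.sum_occupancy_mul (h : IsStationary P π μ) (f : (Fin N → S) → ℝ) :
    ∑ x, occupancy π μ x * ∑ s', globalKernel P x.1 x.2 s' * f s' = ∑ s, μ s * f s := by
  simp only [← h.apply_eq, Finset.mul_sum, Finset.sum_mul]
  rw [Finset.sum_comm]
  simp only [mul_assoc]

lemma IsStationary.sum_occupancy_mul_pairTransition (h : IsStationary P π μ) (y : Pair S N) :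
    ∑ x, occupancy π μ x * pairTransition P π x y = occupancy π μ y := by
  simp only [pairTransition, ← mul_assoc, ← Finset.sum_mul, h.apply_eq]
  rfl

/-- Criticality puts `α` below the mass of `s₀` and all higher states, which is at most one. The
bound is what makes the index policy a probability distribution. -/
lemma le_natCast_of_mem_criticalRegion {ν : S → ℝ} {α : ℝ} {s₀ : S} {m : S → ℝ} {M : ℕ}
    (hm : m ∈ criticalRegion ν α s₀) (hm1 : ∑ s, m s = 1) (hM : (M : ℝ) = α * N) : M ≤ N := by
  classical
  have h : ∑ s' with ν s₀ < ν s', m s' + m s₀ ≤ 1 := by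
    rw [add_comm, ← Finset.sum_insert (by simp), ← hm1]
    exact Finset.sum_le_sum_of_subset_of_nonneg (Finset.subset_univ _) fun s _ _ => hm.1 s
  have hα : α ≤ 1 := by
    have := hm.2.2
    unfold remainingBudget at this
    linarith
  have : (M : ℝ) ≤ N := hM ▸ mul_le_of_le_one_left (Nat.cast_nonneg _) hα
  exact_mod_cast this

variable [DecidableEq S]

/-- In the stationary regime the configuration is within `O(1 / √N)` of the attractor. -/
theorem exists_sum_mul_norm_config_sub_le (hP : ∀ a, P a ∈ Matrix.rowStochastic ℝ S)
    {ν : S → ℝ} (hν : Function.Injective ν) {α : ℝ} {mstar : S → ℝ}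
    (hnd : NonDegenerate ν α mstar) (hugap : UGAP P ν α mstar) :
    ∃ C : ℝ, 0 ≤ C ∧ ∀ N M : ℕ, 0 < N → (M : ℝ) = α * N → M ≤ N →
      ∀ μ : (Fin N → S) → ℝ, IsStationary P (indexPolicy ν M) μ →
        ∑ s, μ s * ‖config s - mstar‖ ≤ C / √N := by
  have hP' := fun a => Matrix.mem_rowStochastic_iff_sum.1 (hP a)
  obtain ⟨T, hT⟩ := exists_iterate_contraction hP hν hnd hugap
  have hL := configMapLip_nonneg (S := S)
  refine ⟨2 * ∑ t ∈ Finset.range T, configMapLip S ^ t * Fintype.card S, by positivity,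
    fun N M hN hM hMN μ hμ => ?_⟩
  -- Mean distance after `t` deterministic steps from a stationary configuration; `E 0` is the
  -- quantity to bound. By stationarity the initial state may be taken to be the outcome of a random
  -- step, which trades `E t` for `E (t + 1)` at the cost of one concentration error amplified by
  -- `t` Lipschitz factors.
  set E : ℕ → ℝ := fun t => ∑ s, μ s * ‖(configMap P ν α)^[t] (config s) - mstar‖ with hE
  have hπ : ∀ s : Fin N → S, ∑ a, indexPolicy ν M s a = 1 := sum_indexPolicy ν hMN
  have hstep : ∀ t, E t ≤ E (t + 1) + configMapLip S ^ t * (Fintype.card S / √N) := by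
    intro t
    have hone : ∀ x : Pair S N, occupancy (indexPolicy ν M) μ x *
        ∑ s', globalKernel P x.1 x.2 s' * ‖(configMap P ν α)^[t] (config s') - mstar‖ ≤
        occupancy (indexPolicy ν M) μ x * (‖(configMap P ν α)^[t + 1] (config x.1) - mstar‖ +
          configMapLip S ^ t * (Fintype.card S / √N)) := by
      rintro ⟨s, a⟩
      by_cases ha : a ∈ priorityActions ν M s
      swap
      · simp [occupancy, indexPolicy, ha]
      refine mul_le_mul_of_nonneg_left ?_ (mul_nonneg (hμ.1.1 s) (indexPolicy_nonneg _ _ _ _))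
      rw [Function.iterate_succ_apply]
      set φ := configMap P ν α (config s) with hφ
      have hφm : φ ∈ stdSimplex ℝ S := configMap_mem_stdSimplex hP (config_mem_stdSimplex hN s)
      calc _ ≤ ∑ s', (globalKernel P s a s' * ‖(configMap P ν α)^[t] φ - mstar‖ +
              configMapLip S ^ t * (globalKernel P s a s' * ‖config s' - φ‖)) := by
            refine Finset.sum_le_sum fun s' _ => ?_
            have hK := globalKernel_nonneg (fun a => (hP' a).1) s a s'
            have h1 := norm_iterate_configMap_sub_le hP ν α (config_mem_stdSimplex hN s') hφm t
            have h2 := norm_sub_le_norm_sub_add_norm_sub ((configMap P ν α)^[t] (config s'))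
              ((configMap P ν α)^[t] φ) mstar
            calc _ ≤ globalKernel P s a s' * (‖(configMap P ν α)^[t] φ - mstar‖ +
                  configMapLip S ^ t * ‖config s' - φ‖) :=
                  mul_le_mul_of_nonneg_left (by linarith) hK
              _ = _ := by ring
        _ ≤ _ := by
            rw [Finset.sum_add_distrib, ← Finset.sum_mul, ← Finset.mul_sum,
              sum_globalKernel fun a => (hP' a).2, one_mul]
            gcongr
            exact sum_globalKernel_mul_norm_le hP hν hN hM ha
    calc E t = _ := (hμ.sum_occupancy_mul _).symm
      _ ≤ _ := Finset.sum_le_sum fun x _ => hone x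
      _ = _ := by
          rw [sum_occupancy_mul_fst hπ (fun s => ‖(configMap P ν α)^[t + 1] (config s) - mstar‖ +
            configMapLip S ^ t * (Fintype.card S / √N))]
          simp only [mul_add, Finset.sum_add_distrib, ← Finset.sum_mul, hμ.1.2, one_mul, hE]
  have htel : ∀ n, E 0 ≤ E n +
      ∑ t ∈ Finset.range n, configMapLip S ^ t * (Fintype.card S / √N) := by
    intro n
    induction n with
    | zero => simp
    | succ n ih =>
      rw [Finset.sum_range_succ]
      linarith [hstep n]
  have hcontr : E T ≤ E 0 / 2 := by
    simp only [hE, Finset.sum_div]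
    refine Finset.sum_le_sum fun s _ => ?_
    rw [mul_div_assoc]
    exact mul_le_mul_of_nonneg_left (hT _ (config_mem_stdSimplex hN s)) (hμ.1.1 s)
  have h := htel T
  have hfin : 2 * (∑ t ∈ Finset.range T, configMapLip S ^ t * Fintype.card S) / √N =
      2 * ∑ t ∈ Finset.range T, configMapLip S ^ t * (Fintype.card S / √N) := by
    rw [mul_div_assoc, Finset.sum_div]
    simp only [mul_div_assoc]
  rw [hfin]
  change E 0 ≤ _
  linarith

end Stationary

/-! ### From kernel discrepancies to the decomposition error -/

section Decomposition

variable {S : Type*} [Fintype S] [DecidableEq S] {P : Fin 2 → Matrix S S ℝ} {N : ℕ}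
  {π : (Fin N → S) → (Fin N → Fin 2) → ℝ} {μ : (Fin N → S) → ℝ}

/-- The distribution of the next pair of agent `i`, given the global pair. -/
noncomputable def agentTransition (P : Fin 2 → Matrix S S ℝ)
    (π : (Fin N → S) → (Fin N → Fin 2) → ℝ) (i : Fin N) (x : Pair S N) (u : S × Fin 2) : ℝ :=
  ∑ y with agentPair i y = u, pairTransition P π x y

/-- The local transition of an agent when the configuration is frozen at `m`. -/
noncomputable def meanFieldTransition (P : Fin 2 → Matrix S S ℝ) (ν : S → ℝ) (α : ℝ) (m : S → ℝ)
    (u u' : S × Fin 2) : ℝ :=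
  P u.2 u.1 u'.1 * meanFieldPolicy ν α m u'.1 u'.2

lemma sum_agentTransition_mul (i : Fin N) (x : Pair S N) (f : S × Fin 2 → ℝ) :
    ∑ u, agentTransition P π i x u * f u = ∑ y, pairTransition P π x y * f (agentPair i y) := by
  rw [← Finset.sum_fiberwise Finset.univ (agentPair i)]
  refine Finset.sum_congr rfl fun u _ => ?_
  rw [agentTransition, Finset.sum_mul]
  exact Finset.sum_congr rfl fun y hy => by rw [(Finset.mem_filter.1 hy).2]

lemma agentTransition_nonneg (hP0 : ∀ a s t, 0 ≤ P a s t) (hπ0 : ∀ s a, 0 ≤ π s a) (i : Fin N)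
    (x : Pair S N) (u : S × Fin 2) : 0 ≤ agentTransition P π i x u :=
  Finset.sum_nonneg fun _ _ => pairTransition_nonneg hP0 hπ0 _ _

lemma sum_agentTransition (hP1 : ∀ a s, ∑ t, P a s t = 1) (hπ : ∀ s, ∑ a, π s a = 1)
    (i : Fin N) (x : Pair S N) : ∑ u, agentTransition P π i x u = 1 := by
  have := sum_agentTransition_mul (P := P) (π := π) i x fun _ => 1
  simp only [mul_one] at this
  rw [this, sum_pairTransition hP1 hπ]

lemma localTransition_eq (i : Fin N) (u u' : S × Fin 2) :
    localTransition P π μ i u u' = (∑ x with agentPair i x = u,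
      occupancy π μ x * agentTransition P π i x u') / agentMarginal (occupancy π μ) i u := by
  unfold localTransition agentTransition
  rw [Finset.sum_comm, Finset.sum_div]
  refine Finset.sum_congr rfl fun x _ => ?_
  rw [← Finset.sum_mul]
  ring

/-- Only an inequality, because pairs of zero marginal have zero rows. -/
lemma sum_localTransition_le (hP1 : ∀ a s, ∑ t, P a s t = 1) (hπ : ∀ s, ∑ a, π s a = 1)
    (i : Fin N) (u : S × Fin 2) : ∑ u', localTransition P π μ i u u' ≤ 1 := by
  simp only [localTransition_eq]
  rw [← Finset.sum_div, Finset.sum_comm]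
  simp only [← Finset.mul_sum, sum_agentTransition hP1 hπ, mul_one]
  exact div_self_le_one _

variable (hρ : ∀ x, 0 ≤ occupancy π μ x)
include hρ

lemma localTransition_nonneg (hP0 : ∀ a s t, 0 ≤ P a s t) (hπ0 : ∀ s a, 0 ≤ π s a) (i : Fin N)
    (u u' : S × Fin 2) : 0 ≤ localTransition P π μ i u u' := by
  rw [localTransition_eq]
  exact div_nonneg (Finset.sum_nonneg fun x _ =>
    mul_nonneg (hρ x) (agentTransition_nonneg hP0 hπ0 _ _ _)) (Finset.sum_nonneg fun x _ => hρ x)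

/-- The division is undone even at pairs of zero marginal, where nonnegativity makes every weight in
the fibre vanish. -/
lemma agentMarginal_mul_localTransition (i : Fin N) (u u' : S × Fin 2) :
    agentMarginal (occupancy π μ) i u * localTransition P π μ i u u' =
      ∑ x with agentPair i x = u, occupancy π μ x * agentTransition P π i x u' := by
  rw [localTransition_eq]
  rcases eq_or_ne (agentMarginal (occupancy π μ) i u) 0 with h | h
  · rw [h, zero_mul]
    have h0 := (Finset.sum_eq_zero_iff_of_nonneg fun x _ => hρ x).1 h
    exact (Finset.sum_eq_zero fun x hx => by rw [h0 x hx, zero_mul]).symm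
  · field_simp

/-- The local transition is the conditional expectation of the transition of the agent, hence
closer in mean to any given local kernel. -/
lemma sum_occupancy_mul_abs_localTransition_sub_le (K : S × Fin 2 → S × Fin 2 → ℝ) (i : Fin N)
    (u' : S × Fin 2) :
    ∑ x, occupancy π μ x * |localTransition P π μ i (agentPair i x) u' - K (agentPair i x) u'| ≤
      ∑ x, occupancy π μ x * |agentTransition P π i x u' - K (agentPair i x) u'| := by
  rw [← Finset.sum_fiberwise Finset.univ (agentPair i),
    ← Finset.sum_fiberwise Finset.univ (agentPair i)
      (fun x => occupancy π μ x * |agentTransition P π i x u' - K (agentPair i x) u'|)]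
  refine Finset.sum_le_sum fun u _ => ?_
  have hm : 0 ≤ agentMarginal (occupancy π μ) i u := Finset.sum_nonneg fun x _ => hρ x
  calc _ = ∑ x with agentPair i x = u,
          occupancy π μ x * |localTransition P π μ i u u' - K u u'| :=
        Finset.sum_congr rfl fun x hx => by rw [(Finset.mem_filter.1 hx).2]
    _ = agentMarginal (occupancy π μ) i u * |localTransition P π μ i u u' - K u u'| := by
        rw [← Finset.sum_mul, agentMarginal]
    _ = |∑ x with agentPair i x = u, occupancy π μ x * (agentTransition P π i x u' - K u u')| := by
        rw [← abs_of_nonneg hm, ← abs_mul, mul_sub,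
          agentMarginal_mul_localTransition hρ, agentMarginal, Finset.sum_mul,
          ← Finset.sum_sub_distrib]
        simp only [mul_sub]
    _ ≤ ∑ x with agentPair i x = u,
          |occupancy π μ x * (agentTransition P π i x u' - K u u')| :=
        Finset.abs_sum_le_sum_abs _ _
    _ = _ := Finset.sum_congr rfl fun x hx => by
        rw [abs_mul, abs_of_nonneg (hρ x), (Finset.mem_filter.1 hx).2]

/-- The decomposition error is controlled by the mean distance of the transitions of the agents
from any common local kernel. -/
lemma decompositionError_le (hP0 : ∀ a s t, 0 ≤ P a s t) (hP1 : ∀ a s, ∑ t, P a s t = 1)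
    (hπ0 : ∀ s a, 0 ≤ π s a) (hπ : ∀ s, ∑ a, π s a = 1) (hμ : IsStationary P π μ)
    {r : Fin 2 → S → ℝ} {rmax : ℝ} (hr : ∀ a s, |r a s| ≤ rmax) (hrmax : 0 ≤ rmax) {γ : ℝ}
    (hγ0 : 0 ≤ γ) (hγ1 : γ < 1) (K : S × Fin 2 → S × Fin 2 → ℝ) :
    decompositionError P r γ π μ ≤ 2 * γ * rmax / (1 - γ) ^ 2 *
      ∑ x, occupancy π μ x * ∑ i, ∑ u, |agentTransition P π i x u - K (agentPair i x) u| := by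
  have h1γ : 0 < 1 - γ := by linarith
  set A := ∑ x, occupancy π μ x * ∑ i, ∑ u, |agentTransition P π i x u - K (agentPair i x) u|
    with hA
  set q : Fin N → S × Fin 2 → ℝ := fun i => localQ P r γ π μ i with hq
  have hqeq : ∀ i u, q i u = r u.2 u.1 + γ * ∑ u', localTransition P π μ i u u' * q i u' :=
    fun i u => resolvent_mulVec_apply (localTransition_nonneg hρ hP0 hπ0 i)
      (sum_localTransition_le hP1 hπ i) hγ0 hγ1 _ u
  have hqb : ∀ i u, |q i u| ≤ rmax / (1 - γ) := fun i =>
    abs_le_of_eq_add_smul_mulVec (localTransition_nonneg hρ hP0 hπ0 i)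
      (sum_localTransition_le hP1 hπ i) hγ0 hγ1 (fun u => hr u.2 u.1) (hqeq i)
  have hQeq : ∀ x : Pair S N, globalQ P r γ π x = globalReward r x +
      γ * ∑ y, pairTransition P π x y * globalQ P r γ π y :=
    resolvent_mulVec_apply (pairTransition_nonneg hP0 hπ0)
      (fun x => (sum_pairTransition hP1 hπ x).le) hγ0 hγ1 _
  set D : Pair S N → ℝ := fun x => globalQ P r γ π x - ∑ i, q i (agentPair i x) with hD
  set g : Pair S N → ℝ := fun x => ∑ i, ∑ u,
    (agentTransition P π i x u - localTransition P π μ i (agentPair i x) u) * q i u with hg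
  -- The rewards cancel exactly, so `D` solves a Bellman equation driven by the kernel mismatch
  -- alone.
  have hDeq : ∀ x, D x = γ * ∑ y, pairTransition P π x y * D y + γ * g x := by
    intro x
    have e1 : ∑ y, pairTransition P π x y * D y =
        ∑ y, pairTransition P π x y * globalQ P r γ π y -
          ∑ i, ∑ u, agentTransition P π i x u * q i u := by
      simp only [hD, mul_sub, Finset.sum_sub_distrib, Finset.mul_sum, sum_agentTransition_mul]
      rw [Finset.sum_comm]
    have e2 : g x = ∑ i, ∑ u, agentTransition P π i x u * q i u -
        ∑ i, ∑ u, localTransition P π μ i (agentPair i x) u * q i u := by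
      simp only [hg, sub_mul, Finset.sum_sub_distrib]
    have e3 : ∑ i, q i (agentPair i x) = globalReward r x +
        γ * ∑ i, ∑ u, localTransition P π μ i (agentPair i x) u * q i u := by
      rw [Finset.mul_sum, globalReward, ← Finset.sum_add_distrib]
      exact Finset.sum_congr rfl fun i _ => hqeq i _
    rw [e1, e2]
    simp only [hD]
    rw [e3, hQeq x]
    ring
  have hG : ∑ x, occupancy π μ x * |g x| ≤ rmax / (1 - γ) * (2 * A) := by
    have hsplit : ∀ x, |g x| ≤ rmax / (1 - γ) *
        (∑ i, ∑ u, |agentTransition P π i x u - K (agentPair i x) u| +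
        ∑ i, ∑ u, |localTransition P π μ i (agentPair i x) u - K (agentPair i x) u|) := by
      intro x
      rw [← Finset.sum_add_distrib, Finset.mul_sum]
      refine (Finset.abs_sum_le_sum_abs _ _).trans (Finset.sum_le_sum fun i _ => ?_)
      rw [← Finset.sum_add_distrib, Finset.mul_sum]
      refine (Finset.abs_sum_le_sum_abs _ _).trans (Finset.sum_le_sum fun u _ => ?_)
      rw [abs_mul, mul_comm]
      refine mul_le_mul (hqb i u) ?_ (abs_nonneg _) (by positivity)
      rw [abs_sub_comm (localTransition _ _ _ _ _ _)]
      exact abs_sub_le _ _ _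
    have hloc : ∑ x, occupancy π μ x *
        ∑ i, ∑ u, |localTransition P π μ i (agentPair i x) u - K (agentPair i x) u| ≤ A := by
      simp only [hA, Finset.mul_sum]
      rw [Finset.sum_comm, Finset.sum_comm (s := (Finset.univ : Finset (Pair S N)))]
      refine Finset.sum_le_sum fun i _ => ?_
      rw [Finset.sum_comm, Finset.sum_comm (s := (Finset.univ : Finset (Pair S N)))]
      exact Finset.sum_le_sum fun u _ => sum_occupancy_mul_abs_localTransition_sub_le hρ K i u
    calc _ ≤ ∑ x, occupancy π μ x * (rmax / (1 - γ) *
          (∑ i, ∑ u, |agentTransition P π i x u - K (agentPair i x) u| +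
          ∑ i, ∑ u, |localTransition P π μ i (agentPair i x) u - K (agentPair i x) u|)) :=
          Finset.sum_le_sum fun x _ => mul_le_mul_of_nonneg_left (hsplit x) (hρ x)
      _ = rmax / (1 - γ) * (A + ∑ x, occupancy π μ x *
          ∑ i, ∑ u, |localTransition P π μ i (agentPair i x) u - K (agentPair i x) u|) := by
          rw [hA, ← Finset.sum_add_distrib, Finset.mul_sum]
          exact Finset.sum_congr rfl fun x _ => by ring
      _ ≤ _ := by
          gcongr
          linarith
  -- Stationarity absorbs the transition, so the weighted norm of `D` reappears on the right with
  -- factor `γ`.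
  have hW : ∑ x, occupancy π μ x * |D x| ≤
      γ * ∑ x, occupancy π μ x * |D x| + γ * ∑ x, occupancy π μ x * |g x| := by
    have hpt : ∀ x, |D x| ≤ γ * ∑ y, pairTransition P π x y * |D y| + γ * |g x| := by
      intro x
      conv_lhs => rw [hDeq x]
      refine (abs_add_le _ _).trans ?_
      rw [abs_mul, abs_mul, abs_of_nonneg hγ0]
      gcongr
      refine (Finset.abs_sum_le_sum_abs _ _).trans (Finset.sum_le_sum fun y _ => ?_)
      rw [abs_mul, abs_of_nonneg (pairTransition_nonneg hP0 hπ0 x y)]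
    have hst : ∑ x, occupancy π μ x * ∑ y, pairTransition P π x y * |D y| =
        ∑ x, occupancy π μ x * |D x| := by
      have : ∀ y, occupancy π μ y * |D y| =
          ∑ x, occupancy π μ x * (pairTransition P π x y * |D y|) := fun y => by
        rw [← hμ.sum_occupancy_mul_pairTransition, Finset.sum_mul]
        simp only [mul_assoc]
      simp only [this, Finset.mul_sum]
      exact Finset.sum_comm
    calc _ ≤ ∑ x, occupancy π μ x * (γ * ∑ y, pairTransition P π x y * |D y| + γ * |g x|) :=
          Finset.sum_le_sum fun x _ => mul_le_mul_of_nonneg_left (hpt x) (hρ x)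
      _ = γ * ∑ x, occupancy π μ x * ∑ y, pairTransition P π x y * |D y| +
          γ * ∑ x, occupancy π μ x * |g x| := by
          rw [Finset.mul_sum, Finset.mul_sum, ← Finset.sum_add_distrib]
          exact Finset.sum_congr rfl fun x _ => by ring
      _ = _ := by rw [hst]
  have hfin : 2 * γ * rmax / (1 - γ) ^ 2 * A = γ * (rmax / (1 - γ) * (2 * A)) / (1 - γ) := by
    field_simp
  change ∑ x, occupancy π μ x * |D x| ≤ _
  rw [hfin, le_div_iff₀ h1γ]
  have := mul_le_mul_of_nonneg_left hG hγ0
  linarith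

end Decomposition

/-! ### Comparison with the frozen mean-field kernel -/

section MeanFieldComparison

variable {S : Type*} [Fintype S] [DecidableEq S] {P : Fin 2 → Matrix S S ℝ} {N : ℕ}

lemma agentTransition_indexPolicy {ν : S → ℝ} (hν : Function.Injective ν) {α : ℝ} {M : ℕ}
    (hN : 0 < N) (hM : (M : ℝ) = α * N) (hMN : M ≤ N) (i : Fin N) (x : Pair S N) (t : S)
    (b : Fin 2) :
    agentTransition P (indexPolicy ν M) i x (t, b) = ∑ s', globalKernel P x.1 x.2 s' *
      if s' i = t then meanFieldPolicy ν α (config s') t b else 0 := by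
  rw [agentTransition, Finset.sum_filter, Fintype.sum_prod_type]
  refine Finset.sum_congr rfl fun s' _ => ?_
  simp only [agentPair, Prod.mk.injEq, pairTransition]
  split_ifs with h
  · simp only [h, true_and]
    rw [← h, ← sum_indexPolicy_eq_meanFieldPolicy hν hN hM hMN, Finset.mul_sum,
      Finset.sum_filter]
  · simp [h]

/-- Writes the frozen kernel as an average over the same next global states as the true one, so that
the two can be compared term by term. -/
lemma meanFieldTransition_eq (hP1 : ∀ a s, ∑ t, P a s t = 1) (ν : S → ℝ) (α : ℝ) (m : S → ℝ)
    (i : Fin N) (x : Pair S N) (t : S) (b : Fin 2) :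
    meanFieldTransition P ν α m (agentPair i x) (t, b) = ∑ s', globalKernel P x.1 x.2 s' *
      if s' i = t then meanFieldPolicy ν α m t b else 0 := by
  have := sum_prod_mul_apply (p := fun i t => P (x.2 i) (x.1 i) t) (fun i => hP1 _ _) i
    (fun t' => if t' = t then meanFieldPolicy ν α m t b else 0)
  simp only [globalKernel]
  rw [this]
  simp [meanFieldTransition, agentPair]

/-- The transitions of the agents differ from the mean-field transition by the distance of the next
configuration from `m`. -/
lemma sum_abs_agentTransition_sub_le (hP0 : ∀ a s t, 0 ≤ P a s t)
    (hP1 : ∀ a s, ∑ t, P a s t = 1) {ν : S → ℝ} (hν : Function.Injective ν) {α : ℝ} {M : ℕ}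
    (hN : 0 < N) (hM : (M : ℝ) = α * N) (hMN : M ≤ N) {m : S → ℝ} (hm : ∀ s, 0 ≤ m s)
    (x : Pair S N) :
    ∑ i, ∑ u, |agentTransition P (indexPolicy ν M) i x u -
        meanFieldTransition P ν α m (agentPair i x) u| ≤
      ∑ s', globalKernel P x.1 x.2 s' *
        (2 * Fintype.card S * (N * ((Fintype.card S + 1) * ‖config s' - m‖))) := by
  have hu : ∀ u : S × Fin 2, ∑ i, |agentTransition P (indexPolicy ν M) i x u -
      meanFieldTransition P ν α m (agentPair i x) u| ≤
      ∑ s', globalKernel P x.1 x.2 s' * (N * ((Fintype.card S + 1) * ‖config s' - m‖)) := by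
    rintro ⟨t, b⟩
    set δ : (Fin N → S) → ℝ :=
      fun s' => |meanFieldPolicy ν α (config s') t b - meanFieldPolicy ν α m t b| with hδ
    have hi : ∀ i, |agentTransition P (indexPolicy ν M) i x (t, b) -
        meanFieldTransition P ν α m (agentPair i x) (t, b)| ≤
        ∑ s', globalKernel P x.1 x.2 s' * if s' i = t then δ s' else 0 := by
      intro i
      rw [agentTransition_indexPolicy hν hN hM hMN, meanFieldTransition_eq hP1,
        ← Finset.sum_sub_distrib]
      refine (Finset.abs_sum_le_sum_abs _ _).trans (Finset.sum_le_sum fun s' _ => ?_)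
      rw [← mul_sub, abs_mul, abs_of_nonneg (globalKernel_nonneg hP0 _ _ _)]
      refine mul_le_mul_of_nonneg_left ?_ (globalKernel_nonneg hP0 _ _ _)
      split_ifs <;> simp [hδ]
    refine (Finset.sum_le_sum fun i _ => hi i).trans ?_
    rw [Finset.sum_comm]
    refine Finset.sum_le_sum fun s' _ => ?_
    -- Summing over agents counts those in `t`. This supplies the weight `config s' t` under which
    -- the policy is Lipschitz.
    rw [← Finset.mul_sum, ← Finset.sum_filter, Finset.sum_const, nsmul_eq_mul,
      ← natCast_mul_config hN, mul_assoc]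
    refine mul_le_mul_of_nonneg_left (mul_le_mul_of_nonneg_left ?_ (Nat.cast_nonneg _))
      (globalKernel_nonneg hP0 _ _ _)
    exact mul_abs_meanFieldPolicy_sub_le ((config_mem_stdSimplex hN s').1 t) (hm t) b
  rw [Finset.sum_comm]
  refine (Finset.sum_le_sum fun u _ => hu u).trans (le_of_eq ?_)
  rw [Finset.sum_const, nsmul_eq_mul, Finset.mul_sum]
  simp only [Finset.card_univ, Fintype.card_prod, Fintype.card_fin, Nat.cast_mul, Nat.cast_ofNat]
  exact Finset.sum_congr rfl fun s' _ => by ring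

end MeanFieldComparison

end RMAB

/-! ### The square-root bound -/

theorem mainTheorem4 {S : Type*} [Fintype S] [DecidableEq S]
    (P : Fin 2 → Matrix S S ℝ) (hP : ∀ a, P a ∈ Matrix.rowStochastic ℝ S)
    (ν : S → ℝ) (hν : Function.Injective ν) (α : ℝ) (mstar : S → ℝ)
    (hnd : RMAB.NonDegenerate ν α mstar) (hugap : RMAB.UGAP P ν α mstar) :
    ∃ C : ℝ, 0 < C ∧
      ∀ (r : Fin 2 → S → ℝ) (rmax : ℝ), (∀ a s, |r a s| ≤ rmax) →
      ∀ γ : ℝ, 0 ≤ γ → γ < 1 →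
      ∀ N M : ℕ, 0 < N → (M : ℝ) = α * N →
      ∀ μ : (Fin N → S) → ℝ, RMAB.IsStationary P (RMAB.indexPolicy ν M) μ →
        RMAB.decompositionError P r γ (RMAB.indexPolicy ν M) μ ≤
          4 * C * γ * Real.sqrt N * rmax / (1 - γ) ^ 2 := by
  have hP' := fun a => Matrix.mem_rowStochastic_iff_sum.1 (hP a)
  obtain ⟨C, hC, hmain⟩ := RMAB.exists_sum_mul_norm_config_sub_le hP hν hnd hugap
  obtain ⟨s₀, hs₀⟩ := hnd.exists_mem_criticalRegion hugap.1.1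
  -- The factor `|S|` counts local states and `|S| + 1` is the Lipschitz constant of the weighted
  -- policy. The two actions and the factor two of `decompositionError_le` make up the `4`; the `+
  -- 1` ensures positivity when `C = 0`.
  refine ⟨Fintype.card S * (Fintype.card S + 1) * C + 1, by positivity, ?_⟩
  intro r rmax hr γ hγ0 hγ1 N M hN hM μ hμ
  have hMN : M ≤ N := RMAB.le_natCast_of_mem_criticalRegion hs₀ hugap.1.2 hM
  have hN' : (0 : ℝ) < N := by exact_mod_cast hN
  have hrmax : 0 ≤ rmax := (abs_nonneg _).trans (hr 0 s₀)
  have h1γ : 0 < 1 - γ := by linarith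
  have hρ : ∀ x, 0 ≤ RMAB.occupancy (RMAB.indexPolicy ν M) μ x :=
    fun x => mul_nonneg (hμ.1.1 _) (RMAB.indexPolicy_nonneg _ _ _ _)
  have hcoef : 0 ≤ 2 * γ * rmax / (1 - γ) ^ 2 := by positivity
  have hA : ∑ x, RMAB.occupancy (RMAB.indexPolicy ν M) μ x *
      ∑ i, ∑ u, |RMAB.agentTransition P (RMAB.indexPolicy ν M) i x u -
        RMAB.meanFieldTransition P ν α mstar (RMAB.agentPair i x) u| ≤
      2 * (Fintype.card S * (Fintype.card S + 1) * C) * √N := by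
    calc _ ≤ ∑ x, RMAB.occupancy (RMAB.indexPolicy ν M) μ x *
          ∑ s', RMAB.globalKernel P x.1 x.2 s' * (2 * Fintype.card S *
            (N * ((Fintype.card S + 1) * ‖RMAB.config s' - mstar‖))) :=
          Finset.sum_le_sum fun x _ => mul_le_mul_of_nonneg_left
            (RMAB.sum_abs_agentTransition_sub_le (fun a => (hP' a).1) (fun a => (hP' a).2)
              hν hN hM hMN hugap.1.1 x) (hρ x)
      _ = 2 * Fintype.card S * (N * (Fintype.card S + 1)) *
          ∑ s, μ s * ‖RMAB.config s - mstar‖ := by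
          rw [hμ.sum_occupancy_mul, Finset.mul_sum]
          exact Finset.sum_congr rfl fun s _ => by ring
      _ ≤ 2 * Fintype.card S * (N * (Fintype.card S + 1)) * (C / √N) := by
          gcongr
          exact hmain N M hN hM hMN μ hμ
      _ = 2 * (Fintype.card S * (Fintype.card S + 1) * C) * (N / √N) := by ring
      _ = _ := by rw [Real.div_sqrt]
  calc _ ≤ _ := RMAB.decompositionError_le hρ (fun a => (hP' a).1) (fun a => (hP' a).2)
        (RMAB.indexPolicy_nonneg ν M) (RMAB.sum_indexPolicy ν hMN) hμ hr hrmax hγ0 hγ1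
        (RMAB.meanFieldTransition P ν α mstar)
    _ ≤ 2 * γ * rmax / (1 - γ) ^ 2 *
        (2 * (Fintype.card S * (Fintype.card S + 1) * C + 1) * √N) := by
        gcongr
        refine hA.trans ?_
        gcongr
        linarith
    _ = _ := by ring
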